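/- Let $m\ge 0$ and let $(M,\eta)$ be a contact manifold of dimension $2m+1$: $M$ is a smooth manifold of dimension $2m+1$ and $\eta$ is a smooth $1$-form on $M$ with $\eta\wedge(d\eta)^m\neq 0$ at every point. Then $\flat(X)=i_X d\eta+\eta(X)\eta$ is an isomorphism $\flat\colon TM\to T^*M$. Let $E=\flat^{-1}(\eta)$ be the Reeb vector field, and let $\Lambda$ be the bivector field $\Lambda(\mu,\nu)=d\eta(\flat^{-1}\mu,\flat^{-1}\nu)$. Write $\Omega^k(M)$ for the space of smooth $k$-forms, with $\Omega^{k}(M)=0$ for $k<0$, and let $i(\Lambda)\colon\Omega^k(M)\to\Omega^{k-2}(M)$ be the contraction by $\Lambda$, normalized by $i(X\wedge Y)\alpha=\alpha(X,Y,\dots)$. Let $\mathcal L_E=d\,i_E+i_E\,d$. For $k\ge 0$ let $C_k=\Omega^k(M)\oplus\Omega^{k-1}(M)$ and define $\delta\colon C_k\to C_{k-1}$ by $$\delta(\alpha,\beta)=\bigl(i(\Lambda)d\alpha-d\,i(\Lambda)\alpha+k\,i_E\alpha+(-1)^k\mathcal L_E\beta,\;\; i(\Lambda)d\beta-d\,i(\Lambda)\beta+(k-1)\,i_E\beta+(-1)^k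 i(\Lambda)\alpha\bigr)$$ (with $\delta=0$ on $C_0$). Then $\delta\circ\delta=0$, and the Lichnerowicz–Jacobi homology of $M$ vanishes: $$H_k^{LJ}(M)=\frac{\ker(\delta\colon C_k\to C_{k-1})}{\operatorname{im}(\delta\colon C_{k+1}\to C_k)}=\{0\}\qquad\text{for all }k\ge 0.$$ More precisely, every $(\alpha,\beta)\in C_k$ with $\delta(\alpha,\beta)=0$ satisfies $$(\alpha,\beta)=\delta\Bigl(\frac{\eta\wedge\alpha}{m+1},\frac{\eta\wedge\beta}{m+1}\Bigr).$$ -/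

import Mathlib

open scoped Manifold ContDiff
noncomputable section

namespace LJ

/-! ### Exterior algebra of one vector space -/

section Linear

variable {V : Type*} [NormedAddCommGroup V] [NormedSpace ℝ V] {k l : ℕ}

/-- The linear functional given by an alternating `1`-form. -/
def covec (a : V [⋀^Fin 1]→L[ℝ] ℝ) : V →L[ℝ] ℝ :=
  (ContinuousAlternatingMap.ofSubsingletonLIE (𝕜 := ℝ) (E := V) (F := ℝ) (0 : Fin 1)).symm a

/-- The exterior product `a ∧ b`, in the normalization
`(a ∧ b) (v₁, …, vₖ₊ₗ) = ∑ sign σ • a (v_σ(1), …, v_σ(k)) * b (v_σ(k+1), …, v_σ(k+l))`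
over the `(k, l)`-shuffles `σ`. -/
def wedge (a : V [⋀^Fin k]→ₗ[ℝ] ℝ) (b : V [⋀^Fin l]→ₗ[ℝ] ℝ) : V [⋀^Fin (k + l)]→ₗ[ℝ] ℝ :=
  ((LinearMap.mul' ℝ ℝ).compAlternatingMap (a.domCoprod b)).domDomCongr finSumFinEquiv

/-- The exterior power `a ∧ … ∧ a` (`m` factors) of a `2`-form `a`. -/
def wedgePow (a : V [⋀^Fin 2]→ₗ[ℝ] ℝ) : (m : ℕ) → V [⋀^Fin (2 * m)]→ₗ[ℝ] ℝ
  | 0 => AlternatingMap.constOfIsEmpty ℝ V (Fin 0) 1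
  | m + 1 => wedge (wedgePow a m) a

/-- The exterior product `a ∧ b` of a `1`-form and a `k`-form as a `(k+1)`-form:
`(a ∧ b) (v₀, …, vₖ) = ∑ i, (-1) ^ i * a vᵢ * b (v₀, …, v̂ᵢ, …, vₖ)`. -/
def wedgeLeft (a : V [⋀^Fin 1]→L[ℝ] ℝ) (b : V [⋀^Fin k]→L[ℝ] ℝ) : V [⋀^Fin (k + 1)]→L[ℝ] ℝ :=
  ContinuousAlternatingMap.alternatizeUncurryFin ((covec a).smulRight b)

/-- The contraction `i(P) a` of a form by a bivector `P` (an alternating bilinear form on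
covectors), normalized by `i(X ∧ Y) a = a (X, Y, …)`. In terms of a basis `eᵢ` with dual basis
`eⁱ`, `P = 1/2 ∑ P(eⁱ, eʲ) eᵢ ∧ eⱼ`. -/
def contract [FiniteDimensional ℝ V] (P : (V →L[ℝ] ℝ) [⋀^Fin 2]→L[ℝ] ℝ)
    (a : V [⋀^Fin (k + 2)]→L[ℝ] ℝ) : V [⋀^Fin k]→L[ℝ] ℝ :=
  let e := Module.finBasis ℝ V
  (1 / 2 : ℝ) • ∑ i, ∑ j,
    P ![(e.coord i).toContinuousLinearMap, (e.coord j).toContinuousLinearMap] •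
      (a.curryLeft (e i)).curryLeft (e j)

/-- The map `♭ X = i_X w + a(X) a` for a `1`-form `a` and a `2`-form `w`. -/
def flat (a : V [⋀^Fin 1]→L[ℝ] ℝ) (w : V [⋀^Fin 2]→L[ℝ] ℝ) : V →L[ℝ] (V →L[ℝ] ℝ) :=
  ((ContinuousAlternatingMap.ofSubsingletonLIE (𝕜 := ℝ) (E := V) (F := ℝ) (0 : Fin 1)).symm.toContinuousLinearEquiv :
      (V [⋀^Fin 1]→L[ℝ] ℝ) →L[ℝ] (V →L[ℝ] ℝ)) ∘L w.curryLeft +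
    (covec a).smulRight (covec a)

@[simp] theorem covec_apply (a : V [⋀^Fin 1]→L[ℝ] ℝ) (v : V) : covec a v = a ![v] := by
  simp only [covec]
  change a _ = _
  congr 1; ext i; fin_cases i; rfl

theorem flat_apply (a : V [⋀^Fin 1]→L[ℝ] ℝ) (w : V [⋀^Fin 2]→L[ℝ] ℝ) (v u : V) :
    flat a w v u = w ![v, u] + a ![v] * a ![u] := by
  have : (flat a w v : V →L[ℝ] ℝ) = covec (w.curryLeft v) + covec a v • covec a := rfl
  rw [this]; simp

/-- If `a` and `b` vanish as soon as one argument is `v`, so does `a ∧ b`. -/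
theorem wedge_apply_eq_zero {a : V [⋀^Fin k]→ₗ[ℝ] ℝ} {b : V [⋀^Fin l]→ₗ[ℝ] ℝ} {v : V}
    (ha : ∀ u i, u i = v → a u = 0) (hb : ∀ u i, u i = v → b u = 0)
    (u : Fin (k + l) → V) (i : Fin (k + l)) (hu : u i = v) : wedge a b u = 0 := by
  have : a.domCoprod b (u ∘ finSumFinEquiv) = 0 := by
    rw [AlternatingMap.domCoprod_apply, FunLike.coe_sum, Finset.sum_apply]
    refine Finset.sum_eq_zero fun σ _ => ?_
    induction σ using Quotient.inductionOn' with | _ σ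
    rw [AlternatingMap.domCoprod.summand_mk'']
    simp only [_root_.smul_apply, MultilinearMap.domDomCongr_apply, MultilinearMap.domCoprod_apply]
    rcases hj : σ.symm (finSumFinEquiv.symm i) with j | j
    · have hj' : finSumFinEquiv (σ (Sum.inl j)) = i := by
        rw [← hj]; simp
      have := ha (fun t => u (finSumFinEquiv (σ (Sum.inl t)))) j (by simp only [hj', hu])
      simp [this]
    · have hj' : finSumFinEquiv (σ (Sum.inr j)) = i := by
        rw [← hj]; simp
      have := hb (fun t => u (finSumFinEquiv (σ (Sum.inr t)))) j (by simp only [hj', hu])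
      simp [this]
  simp only [wedge, AlternatingMap.domDomCongr_apply, LinearMap.compAlternatingMap_apply]
  rw [this, map_zero]

theorem wedgePow_apply_eq_zero {a : V [⋀^Fin 2]→ₗ[ℝ] ℝ} {v : V}
    (ha : ∀ u i, u i = v → a u = 0) (m : ℕ) (u : Fin (2 * m) → V) (i) (hu : u i = v) :
    wedgePow a m u = 0 := by
  induction m with
  | zero => exact i.elim0
  | succ m ih => exact wedge_apply_eq_zero ih ha u i hu

/-- If `a ∧ w ^ m` is non-zero in dimension `2 m + 1` then `♭` is an isomorphism. -/
theorem flat_isInvertible [FiniteDimensional ℝ V] {m : ℕ} (hV : Module.finrank ℝ V = 2 * m + 1)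
    {a : V [⋀^Fin 1]→L[ℝ] ℝ} {w : V [⋀^Fin 2]→L[ℝ] ℝ}
    (h : wedge a.toAlternatingMap (wedgePow w.toAlternatingMap m) ≠ 0) :
    (flat a w).IsInvertible := by
  have inj : Function.Injective (flat a w) := by
    rw [injective_iff_map_eq_zero]
    intro v hv
    by_contra hv0
    apply h
    have h1 : a ![v] = 0 := by
      have := flat_apply a w v v
      rw [hv, w.map_eq_zero_of_eq ![v, v] (i := 0) (j := 1) rfl (by simp)] at this
      simpa using this
    have h2 : ∀ u, w ![v, u] = 0 := fun u => by
      have := flat_apply a w v u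
      rw [hv, h1] at this
      simpa using this.symm
    have ha : ∀ u i, u i = v → a.toAlternatingMap u = 0 := by
      intro u i hu
      fin_cases i
      rw [← h1]
      change a u = _
      congr 1; ext i; fin_cases i; exact hu
    have hw : ∀ u i, u i = v → w.toAlternatingMap u = 0 := by
      intro u i hu
      change w u = 0
      fin_cases i
      · rw [← h2 (u 1)]; congr 1; ext i; fin_cases i; exacts [hu, rfl]
      · have := w.toAlternatingMap.map_swap u (i := 0) (j := 1) (by simp)
        change w _ = - w _ at this
        rw [← neg_eq_zero, ← this, ← h2 (u 0)]
        congr 1; ext i; fin_cases i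
        · simpa using hu
        · simp
    have hli : LinearIndepOn ℝ id ({v} : Set V) := LinearIndepOn.singleton (by simpa using hv0)
    let e := Module.Basis.extend hli
    have hmem : v ∈ hli.extend (Set.subset_univ _) :=
      hli.subset_extend (Set.subset_univ _) rfl
    refine Module.Basis.ext_alternating e fun i hi => ?_
    have hsurj : Function.Surjective i := by
      have : Fintype (hli.extend (Set.subset_univ _)) := FiniteDimensional.fintypeBasisIndex e
      refine ((Fintype.bijective_iff_injective_and_card i).2 ⟨hi, ?_⟩).2
      rw [← Module.finrank_eq_card_basis e, hV, Fintype.card_fin, add_comm]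
    obtain ⟨j, hj⟩ := hsurj ⟨v, hmem⟩
    refine wedge_apply_eq_zero ha (wedgePow_apply_eq_zero hw m) _ j ?_
    rw [hj, Module.Basis.extend_apply_self]
  have hfr : Module.finrank ℝ V = Module.finrank ℝ (V →L[ℝ] ℝ) := by
    rw [← Subspace.dual_finrank_eq]
    exact (LinearMap.toContinuousLinearMap (𝕜 := ℝ) (E := V) (F' := ℝ)).finrank_eq
  refine ⟨(LinearEquiv.ofInjectiveOfFinrankEq (flat a w : V →ₗ[ℝ] (V →L[ℝ] ℝ)) inj
    hfr).toContinuousLinearEquiv, ?_⟩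
  ext v u
  rfl


/-! Behaviour under linear isomorphisms -/

theorem wedgeLeft_add (a : V [⋀^Fin 1]→L[ℝ] ℝ) (b c : V [⋀^Fin k]→L[ℝ] ℝ) :
    wedgeLeft a (b + c) = wedgeLeft a b + wedgeLeft a c := by
  rw [wedgeLeft, wedgeLeft, wedgeLeft, ← ContinuousAlternatingMap.alternatizeUncurryFin_add]
  congr 1
  ext; simp

theorem wedgeLeft_smul (r : ℝ) (a : V [⋀^Fin 1]→L[ℝ] ℝ) (b : V [⋀^Fin k]→L[ℝ] ℝ) :
    wedgeLeft a (r • b) = r • wedgeLeft a b := by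
  rw [wedgeLeft, wedgeLeft, ← ContinuousAlternatingMap.alternatizeUncurryFin_smul]
  congr 1
  ext; simp; ring

theorem wedgeLeft_comp (a : V [⋀^Fin 1]→L[ℝ] ℝ) (b : V [⋀^Fin k]→L[ℝ] ℝ) (A : V →L[ℝ] V) :
    wedgeLeft (a.compContinuousLinearMap A) (b.compContinuousLinearMap A) =
      (wedgeLeft a b).compContinuousLinearMap A := by
  ext v
  simp only [wedgeLeft, ContinuousAlternatingMap.alternatizeUncurryFin_apply,
    ContinuousLinearMap.smulRight_apply, covec_apply,
    ContinuousAlternatingMap.compContinuousLinearMap_apply]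
  refine Finset.sum_congr rfl fun i _ => ?_
  have : A ∘ ![v i] = ![A (v i)] := by ext j; fin_cases j; rfl
  rw [this]
  rfl

theorem flat_comp (a : V [⋀^Fin 1]→L[ℝ] ℝ) (w : V [⋀^Fin 2]→L[ℝ] ℝ) (A : V →L[ℝ] V) :
    flat (a.compContinuousLinearMap A) (w.compContinuousLinearMap A) =
      A.precomp ℝ ∘L flat a w ∘L A := by
  ext v u
  simp only [flat_apply, ContinuousLinearMap.comp_apply, ContinuousLinearMap.precomp_apply,
    ContinuousAlternatingMap.compContinuousLinearMap_apply]
  have h1 : ∀ u, A ∘ ![u] = ![A u] := fun u => by ext j; fin_cases j; rfl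
  have h2 : A ∘ ![v, u] = ![A v, A u] := by ext j; fin_cases j <;> rfl
  simp only [h1, h2]

theorem covec_comp_comp {A B : V →L[ℝ] V} (hAB : A ∘L B = .id ℝ V) (a : V [⋀^Fin 1]→L[ℝ] ℝ) :
    covec (a.compContinuousLinearMap A) ∘L B = covec a := by
  ext v
  have hAB' : A (B v) = v := DFunLike.congr_fun hAB v
  have h1 : A ∘ ![B v] = ![v] := by ext j; fin_cases j; exact hAB'
  simp [h1]

theorem flat_inverse_comp {a : V [⋀^Fin 1]→L[ℝ] ℝ} {w : V [⋀^Fin 2]→L[ℝ] ℝ} {A B : V →L[ℝ] V}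
    (hAB : A ∘L B = .id ℝ V) (hBA : B ∘L A = .id ℝ V) (h : (flat a w).IsInvertible) :
    (flat (a.compContinuousLinearMap A) (w.compContinuousLinearMap A)).inverse =
      B ∘L (flat a w).inverse ∘L B.precomp ℝ := by
  have hAB' : ∀ v, A (B v) = v := fun v => DFunLike.congr_fun hAB v
  have hBA' : ∀ v, B (A v) = v := fun v => DFunLike.congr_fun hBA v
  rw [flat_comp]
  refine ContinuousLinearMap.inverse_eq ?_ ?_
  · ext c v
    simp [hAB', hBA', h.self_apply_inverse]
  · ext v
    have : (flat a w (A v) ∘L A) ∘L B = flat a w (A v) := by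
      rw [ContinuousLinearMap.comp_assoc, hAB]; rfl
    simp [this, h.inverse_apply_self, hBA']

theorem flat_isInvertible_comp {a : V [⋀^Fin 1]→L[ℝ] ℝ} {w : V [⋀^Fin 2]→L[ℝ] ℝ}
    {A B : V →L[ℝ] V}
    (hAB : A ∘L B = .id ℝ V) (hBA : B ∘L A = .id ℝ V) (h : (flat a w).IsInvertible) :
    (flat (a.compContinuousLinearMap A) (w.compContinuousLinearMap A)).IsInvertible := by
  have hA : A.IsInvertible := .of_inverse hAB hBA
  have hA' : (A.precomp ℝ : (V →L[ℝ] ℝ) →L[ℝ] (V →L[ℝ] ℝ)).IsInvertible := by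
    refine ContinuousLinearMap.IsInvertible.of_inverse
      (g := (B.precomp ℝ : (V →L[ℝ] ℝ) →L[ℝ] (V →L[ℝ] ℝ))) ?_ ?_
    · ext c v
      simp [show ∀ v, B (A v) = v from fun v => DFunLike.congr_fun hBA v]
    · ext c v
      simp [show ∀ v, A (B v) = v from fun v => DFunLike.congr_fun hAB v]
  rw [flat_comp]
  exact hA'.comp (h.comp hA)

section Contract

variable [FiniteDimensional ℝ V]

/-- Invariance of `∑ φ (eⁱ, eᵢ)` under a change of basis. -/
theorem sum_dual_comp {ι : Type*} [Fintype ι] (e : Module.Basis ι ℝ V) {A B : V →L[ℝ] V}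
    (hAB : A ∘L B = .id ℝ V) (φ : (V →L[ℝ] ℝ) →ₗ[ℝ] V →ₗ[ℝ] ℝ) :
    ∑ i, φ ((e.coord i).toContinuousLinearMap ∘L B) (A (e i)) =
      ∑ i, φ (e.coord i).toContinuousLinearMap (e i) := by
  classical
  have h1 : ∀ i, (e.coord i).toContinuousLinearMap ∘L B =
      ∑ j, (e.coord i (B (e j))) • (e.coord j).toContinuousLinearMap := by
    intro i
    ext v
    simp only [ContinuousLinearMap.comp_apply, LinearMap.coe_toContinuousLinearMap', _root_.sum_apply,
      _root_.smul_apply, smul_eq_mul]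
    conv_lhs => rw [← e.sum_repr v]
    simp only [map_sum, map_smul, smul_eq_mul, Module.Basis.coord_apply, mul_comm]
  have h2 : ∀ j, ∑ i, e.coord i (B (e j)) • A (e i) = e j := by
    intro j
    have h3 : A (B (e j)) = e j := DFunLike.congr_fun hAB (e j)
    have h4 := congrArg A (e.sum_repr (B (e j)))
    rw [h3, map_sum] at h4
    simpa only [map_smul, Module.Basis.coord_apply] using h4
  simp only [h1, map_sum, LinearMap.sum_apply, map_smul, LinearMap.smul_apply]
  rw [Finset.sum_comm]
  refine Finset.sum_congr rfl fun j _ => ?_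
  have h5 := congrArg (φ (e.coord j).toContinuousLinearMap) (h2 j)
  rw [← h5]
  simp only [map_sum, map_smul]

theorem contract_apply (P : (V →L[ℝ] ℝ) [⋀^Fin 2]→L[ℝ] ℝ) (a : V [⋀^Fin (k + 2)]→L[ℝ] ℝ)
    (v : Fin k → V) :
    contract P a v = 1 / 2 * ∑ i, ∑ j,
      P ![((Module.finBasis ℝ V).coord i).toContinuousLinearMap,
        ((Module.finBasis ℝ V).coord j).toContinuousLinearMap] *
      ((a.curryLeft (Module.finBasis ℝ V i)).curryLeft (Module.finBasis ℝ V j)) v := by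
  simp only [contract, ContinuousAlternatingMap.smul_apply, ContinuousAlternatingMap.sum_apply,
    smul_eq_mul]

theorem contract_add (P : (V →L[ℝ] ℝ) [⋀^Fin 2]→L[ℝ] ℝ) (a b : V [⋀^Fin (k + 2)]→L[ℝ] ℝ) :
    contract P (a + b) = contract P a + contract P b := by
  ext v
  rw [ContinuousAlternatingMap.add_apply, contract_apply, contract_apply, contract_apply,
    ← mul_add, ← Finset.sum_add_distrib]
  simp only [← Finset.sum_add_distrib, ← mul_add]
  rfl

theorem contract_smul (r : ℝ) (P : (V →L[ℝ] ℝ) [⋀^Fin 2]→L[ℝ] ℝ)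
    (a : V [⋀^Fin (k + 2)]→L[ℝ] ℝ) : contract P (r • a) = r • contract P a := by
  ext v
  rw [ContinuousAlternatingMap.smul_apply, contract_apply, contract_apply, smul_eq_mul,
    mul_left_comm r]
  congr 1
  simp only [Finset.mul_sum]
  refine Finset.sum_congr rfl fun i _ => Finset.sum_congr rfl fun j _ => ?_
  rw [← mul_left_comm]
  rfl

theorem contract_comp (P : (V →L[ℝ] ℝ) [⋀^Fin 2]→L[ℝ] ℝ) (a : V [⋀^Fin (k + 2)]→L[ℝ] ℝ)
    {A B : V →L[ℝ] V} (hAB : A ∘L B = .id ℝ V) :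
    contract (P.compContinuousLinearMap (B.precomp ℝ)) (a.compContinuousLinearMap A) =
      (contract P a).compContinuousLinearMap A := by
  ext v
  let e := Module.finBasis ℝ V
  have key : ∀ (F : (V →L[ℝ] ℝ) → (V →L[ℝ] ℝ) → V → V → ℝ)
      (h1 : ∀ x₁ x₂ y u v, F (x₁ + x₂) y u v = F x₁ y u v + F x₂ y u v)
      (h1' : ∀ (c : ℝ) x y u v, F (c • x) y u v = c * F x y u v)
      (h2 : ∀ x y₁ y₂ u v, F x (y₁ + y₂) u v = F x y₁ u v + F x y₂ u v)
      (h2' : ∀ (c : ℝ) x y u v, F x (c • y) u v = c * F x y u v)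
      (h3 : ∀ x y u₁ u₂ v, F x y (u₁ + u₂) v = F x y u₁ v + F x y u₂ v)
      (h3' : ∀ (c : ℝ) x y u v, F x y (c • u) v = c * F x y u v)
      (h4 : ∀ x y u v₁ v₂, F x y u (v₁ + v₂) = F x y u v₁ + F x y u v₂)
      (h4' : ∀ (c : ℝ) x y u v, F x y u (c • v) = c * F x y u v),
      ∑ i, ∑ j, F ((e.coord i).toContinuousLinearMap ∘L B)
        ((e.coord j).toContinuousLinearMap ∘L B) (A (e i)) (A (e j)) =
      ∑ i, ∑ j, F (e.coord i).toContinuousLinearMap (e.coord j).toContinuousLinearMap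
        (e i) (e j) := by
    intro F h1 h1' h2 h2' h3 h3' h4 h4'
    have hin : ∀ x u, ∑ j, F x ((e.coord j).toContinuousLinearMap ∘L B) u (A (e j)) =
        ∑ j, F x (e.coord j).toContinuousLinearMap u (e j) := fun x u =>
      sum_dual_comp e hAB (LinearMap.mk₂ ℝ (fun y v => F x y u v)
        (fun _ _ _ => h2 ..) (fun _ _ _ => h2' ..) (fun _ _ _ => h4 ..) (fun _ _ _ => h4' ..))
    simp only [hin]
    refine sum_dual_comp e hAB (LinearMap.mk₂ ℝ
      (fun x u => ∑ j, F x (e.coord j).toContinuousLinearMap u (e j)) ?_ ?_ ?_ ?_)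
    · intros; simp only [h1, Finset.sum_add_distrib]
    · intros; simp only [h1', Finset.mul_sum, smul_eq_mul]
    · intros; simp only [h3, Finset.sum_add_distrib]
    · intros; simp only [h3', Finset.mul_sum, smul_eq_mul]
  have := key (fun x y u u' => P ![x, y] * (a.curryLeft u).curryLeft u' (A ∘ v))
    (fun x₁ x₂ y u v => by
      have := P.toAlternatingMap.map_vecCons_add ![y] x₁ x₂
      change P _ = P _ + P _ at this
      rw [this, add_mul])
    (fun c x y u v => by
      have := P.toAlternatingMap.map_vecCons_smul ![y] c x
      change P _ = c * P _ at this
      rw [this, mul_assoc])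
    (fun x y₁ y₂ u v => by
      have := (P.curryLeft x).toAlternatingMap.map_vecCons_add ![] y₁ y₂
      change P ![x, y₁ + y₂] = P ![x, y₁] + P ![x, y₂] at this
      rw [this, add_mul])
    (fun c x y u v => by
      have := (P.curryLeft x).toAlternatingMap.map_vecCons_smul ![] c y
      change P ![x, c • y] = c * P ![x, y] at this
      rw [this, mul_assoc])
    (fun x y u₁ u₂ v => by simp [-ContinuousAlternatingMap.curryLeft_apply_apply, mul_add])
    (fun c x y u v => by simp [-ContinuousAlternatingMap.curryLeft_apply_apply]; ring)
    (fun x y u v₁ v₂ => by simp [-ContinuousAlternatingMap.curryLeft_apply_apply, mul_add])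
    (fun c x y u v => by simp [-ContinuousAlternatingMap.curryLeft_apply_apply]; ring)
  rw [contract_apply, ContinuousAlternatingMap.compContinuousLinearMap_apply, contract_apply]
  congr 1
  refine Eq.trans (Finset.sum_congr rfl fun i _ => Finset.sum_congr rfl fun j _ => ?_) this
  rw [ContinuousAlternatingMap.curryLeft_compContinuousLinearMap,
    ContinuousAlternatingMap.curryLeft_compContinuousLinearMap,
    ContinuousAlternatingMap.compContinuousLinearMap_apply,
    ContinuousAlternatingMap.compContinuousLinearMap_apply]
  congr 2
  ext t; fin_cases t <;> rfl

end Contract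

/-! Smooth dependence -/

section Smooth

variable {s : Set V}

theorem contDiffOn_covec {a : V → V [⋀^Fin 1]→L[ℝ] ℝ} (ha : ContDiffOn ℝ ∞ a s) :
    ContDiffOn ℝ ∞ (fun y => covec (a y)) s :=
  (ContinuousAlternatingMap.ofSubsingletonLIE (𝕜 := ℝ) (E := V) (F := ℝ)
    (0 : Fin 1)).symm.contDiff.comp_contDiffOn ha

theorem contDiffOn_wedgeLeft {a : V → V [⋀^Fin 1]→L[ℝ] ℝ} {b : V → V [⋀^Fin k]→L[ℝ] ℝ}
    (ha : ContDiffOn ℝ ∞ a s) (hb : ContDiffOn ℝ ∞ b s) :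
    ContDiffOn ℝ ∞ (fun y => wedgeLeft (a y) (b y)) s := by
  have h1 := contDiffOn_covec ha
  exact (ContinuousAlternatingMap.alternatizeUncurryFinCLM ℝ V ℝ).contDiff.comp_contDiffOn
    (h1.smulRight hb)

theorem contDiffOn_curry {a : V → V [⋀^Fin (k + 1)]→L[ℝ] ℝ} (ha : ContDiffOn ℝ ∞ a s) :
    ContDiffOn ℝ ∞ (fun y => (a y).curryLeft) s := by
  let C : (V [⋀^Fin (k + 1)]→L[ℝ] ℝ) →L[ℝ] (V →L[ℝ] V [⋀^Fin k]→L[ℝ] ℝ) :=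
    (ContinuousAlternatingMap.curryLeftLI (𝕜 := ℝ) (E := V) (F := ℝ)
      (n := k)).toContinuousLinearMap
  exact (ContinuousLinearMap.contDiff (E := V [⋀^Fin (k + 1)]→L[ℝ] ℝ)
    (F := V →L[ℝ] V [⋀^Fin k]→L[ℝ] ℝ) C).comp_contDiffOn ha

theorem contDiffOn_curryLeft {a : V → V [⋀^Fin (k + 1)]→L[ℝ] ℝ} {X : V → V}
    (ha : ContDiffOn ℝ ∞ a s) (hX : ContDiffOn ℝ ∞ X s) :
    ContDiffOn ℝ ∞ (fun y => (a y).curryLeft (X y)) s :=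
  ContDiffOn.clm_apply (f := fun y => (a y).curryLeft)
    (contDiffOn_curry ha) hX

theorem contDiffOn_flat {a : V → V [⋀^Fin 1]→L[ℝ] ℝ} {w : V → V [⋀^Fin 2]→L[ℝ] ℝ}
    (ha : ContDiffOn ℝ ∞ a s) (hw : ContDiffOn ℝ ∞ w s) :
    ContDiffOn ℝ ∞ (fun y => flat (a y) (w y)) s := by
  have h1 := contDiffOn_covec ha
  have h2 : ContDiffOn ℝ ∞ (fun y => (w y).curryLeft) s :=
    contDiffOn_curry hw
  exact (contDiffOn_const.clm_comp h2).add (h1.smulRight h1)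

theorem contDiffOn_comp_two {W : Type*} [NormedAddCommGroup W] [NormedSpace ℝ W]
    {w : V → V [⋀^Fin 2]→L[ℝ] ℝ} {G : V → W →L[ℝ] V}
    (hw : ContDiffOn ℝ ∞ w s) (hG : ContDiffOn ℝ ∞ G s) :
    ContDiffOn ℝ ∞ (fun y => (w y).compContinuousLinearMap (G y)) s := by
  let S : (V [⋀^Fin 1]→L[ℝ] ℝ) →L[ℝ] (V →L[ℝ] ℝ) :=
    (ContinuousAlternatingMap.ofSubsingletonLIE (𝕜 := ℝ) (E := V) (F := ℝ)
      (0 : Fin 1)).symm.toContinuousLinearEquiv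
  let T : (W →L[ℝ] ℝ) →L[ℝ] (W [⋀^Fin 1]→L[ℝ] ℝ) :=
    (ContinuousAlternatingMap.ofSubsingletonLIE (𝕜 := ℝ) (E := W) (F := ℝ)
      (0 : Fin 1)).toContinuousLinearEquiv
  have hw' : ContDiffOn ℝ ∞ (fun y => (w y).curryLeft) s :=
    contDiffOn_curry hw
  have hG' : ContDiffOn ℝ ∞
      (fun y => (ContinuousLinearMap.compL ℝ W V ℝ).flip (G y)) s :=
    contDiffOn_const.clm_apply hG
  have key : ∀ y, (w y).compContinuousLinearMap (G y) =
      (1 / 2 : ℝ) • ContinuousAlternatingMap.alternatizeUncurryFinCLM ℝ W ℝ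
        (T ∘L (ContinuousLinearMap.compL ℝ W V ℝ).flip (G y) ∘L S ∘L (w y).curryLeft ∘L G y) := by
    intro y
    have h1 : T ∘L (ContinuousLinearMap.compL ℝ W V ℝ).flip (G y) ∘L S ∘L (w y).curryLeft ∘L G y =
        ((w y).compContinuousLinearMap (G y)).curryLeft := by
      ext u v
      rw [ContinuousAlternatingMap.curryLeft_compContinuousLinearMap]
      change ((w y).curryLeft (G y u)) (fun _ => G y (v 0)) =
        ((w y).curryLeft (G y u)) (fun i => G y (v i))
      congr 1; ext i; fin_cases i; rfl
    rw [h1, ContinuousAlternatingMap.alternatizeUncurryFinCLM_apply,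
      ContinuousAlternatingMap.alternatizeUncurryFin_curryLeft]
    ext v
    simp
  simp only [key]
  have h2 : ContDiffOn ℝ ∞ (fun y =>
      T ∘L (ContinuousLinearMap.compL ℝ W V ℝ).flip (G y) ∘L S ∘L (w y).curryLeft ∘L G y) s :=
    contDiffOn_const.clm_comp (hG'.clm_comp (contDiffOn_const.clm_comp (hw'.clm_comp hG)))
  have h3 : ContDiffOn ℝ ∞ (fun y => ContinuousAlternatingMap.alternatizeUncurryFinCLM ℝ W ℝ
      (T ∘L (ContinuousLinearMap.compL ℝ W V ℝ).flip (G y) ∘L S ∘L (w y).curryLeft ∘L G y)) s :=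
    contDiffOn_const.clm_apply h2
  exact h3.const_smul (1 / 2 : ℝ)

variable [FiniteDimensional ℝ V]

theorem contDiffOn_flat_inverse {a : V → V [⋀^Fin 1]→L[ℝ] ℝ} {w : V → V [⋀^Fin 2]→L[ℝ] ℝ}
    (ha : ContDiffOn ℝ ∞ a s) (hw : ContDiffOn ℝ ∞ w s)
    (h : ∀ y ∈ s, (flat (a y) (w y)).IsInvertible) :
    ContDiffOn ℝ ∞ (fun y => (flat (a y) (w y)).inverse) s := fun y hy =>
  haveI : CompleteSpace V := FiniteDimensional.complete ℝ V
  ContDiffAt.comp_contDiffWithinAt (g := ContinuousLinearMap.inverse) y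
    (h y hy).contDiffAt_map_inverse (contDiffOn_flat ha hw y hy)

theorem contDiffOn_contract {P : V → (V →L[ℝ] ℝ) [⋀^Fin 2]→L[ℝ] ℝ}
    {a : V → V [⋀^Fin (k + 2)]→L[ℝ] ℝ}
    (hP : ContDiffOn ℝ ∞ P s) (ha : ContDiffOn ℝ ∞ a s) :
    ContDiffOn ℝ ∞ (fun y => contract (P y) (a y)) s := by
  unfold contract
  refine ContDiffOn.const_smul (1 / 2 : ℝ)
    (f := fun y => ∑ i, ∑ j,
      P y ![((Module.finBasis ℝ V).coord i).toContinuousLinearMap,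
        ((Module.finBasis ℝ V).coord j).toContinuousLinearMap] •
      ((a y).curryLeft (Module.finBasis ℝ V i)).curryLeft (Module.finBasis ℝ V j))
    (ContDiffOn.sum fun i _ => ContDiffOn.sum fun j _ => ?_)
  have h0 : ∀ c : Fin 2 → V →L[ℝ] ℝ,
      ContDiff ℝ ∞ (fun Q : (V →L[ℝ] ℝ) [⋀^Fin 2]→L[ℝ] ℝ => Q c) := by
    intro c
    refine IsBoundedLinearMap.contDiff
      (IsLinearMap.with_bound ⟨fun _ _ => rfl, fun _ _ => rfl⟩ (∏ i, ‖c i‖) fun Q => ?_)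
    rw [mul_comm]
    exact Q.le_opNorm c
  have h1 : ContDiffOn ℝ ∞ (fun y => P y ![((Module.finBasis ℝ V).coord i).toContinuousLinearMap,
      ((Module.finBasis ℝ V).coord j).toContinuousLinearMap]) s :=
    (h0 _).comp_contDiffOn hP
  have h2 : ContDiffOn ℝ ∞ (fun y =>
      ((a y).curryLeft (Module.finBasis ℝ V i)).curryLeft (Module.finBasis ℝ V j)) s :=
    contDiffOn_curryLeft (contDiffOn_curryLeft ha contDiffOn_const) contDiffOn_const
  exact h1.smul h2

end Smooth

end Linear

/-! ### Differential forms and multivector fields on manifolds -/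

section Manifold

variable {V : Type*} [NormedAddCommGroup V] [NormedSpace ℝ V]
  {M : Type*} [TopologicalSpace M] [ChartedSpace V M] {k : ℕ}

/-- The derivative `T_x M → V` at `x` of the chart around `x₀`. -/
def chartPush (x₀ x : M) : TangentSpace 𝓘(ℝ, V) x →L[ℝ] V :=
  mfderiv 𝓘(ℝ, V) 𝓘(ℝ, V) (chartAt V x₀) x

/-- The derivative `V → T_x M`, `x = φ⁻¹ y`, at `y` of the inverse `φ⁻¹` of the chart `φ`
around `x₀`. -/
def chartPull (x₀ : M) (y : V) :
    V →L[ℝ] TangentSpace 𝓘(ℝ, V) ((chartAt V x₀).symm y) :=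
  mfderiv 𝓘(ℝ, V) 𝓘(ℝ, V) (chartAt V x₀).symm y

/-- The expression of a `k`-form in the chart around `x₀`: its pullback by the inverse chart. -/
def formInChart (a : ∀ x : M, TangentSpace 𝓘(ℝ, V) x [⋀^Fin k]→L[ℝ] ℝ) (x₀ : M) (y : V) :
    V [⋀^Fin k]→L[ℝ] ℝ :=
  (a ((chartAt V x₀).symm y)).compContinuousLinearMap (chartPull x₀ y)

/-- The expression of a vector field in the chart around `x₀`. -/
def vectorInChart (X : ∀ x : M, TangentSpace 𝓘(ℝ, V) x) (x₀ : M) (y : V) : V :=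
  chartPush x₀ ((chartAt V x₀).symm y) (X ((chartAt V x₀).symm y))

/-- The expression of a bivector field in the chart around `x₀`. -/
def bivectorInChart (P : ∀ x : M, (TangentSpace 𝓘(ℝ, V) x →L[ℝ] ℝ) [⋀^Fin 2]→L[ℝ] ℝ)
    (x₀ : M) (y : V) : (V →L[ℝ] ℝ) [⋀^Fin 2]→L[ℝ] ℝ :=
  (P ((chartAt V x₀).symm y)).compContinuousLinearMap
    ((chartPush x₀ ((chartAt V x₀).symm y)).precomp ℝ)

variable (V M) in
/-- The space of smooth `k`-forms as a subspace of the space of all sections of `⋀^k T^*M`: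
a form is smooth if its expressions in charts are smooth. -/
def formSubmodule (k : ℕ) :
    Submodule ℝ (∀ x : M, TangentSpace 𝓘(ℝ, V) x [⋀^Fin k]→L[ℝ] ℝ) where
  carrier := {a | ∀ x₀, ContDiffOn ℝ ∞ (formInChart a x₀) (chartAt V x₀).target}
  add_mem' ha hb x₀ := (ha x₀).add (hb x₀)
  zero_mem' _ := contDiffOn_const (c := 0)
  smul_mem' c _ ha x₀ := (ha x₀).const_smul c

variable (V M) in
/-- The real vector space `Ω^k(M)` of smooth differential `k`-forms. -/
def Form (k : ℕ) : Type _ := formSubmodule V M k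

instance (k : ℕ) : AddCommGroup (Form V M k) := inferInstanceAs (AddCommGroup (formSubmodule V M k))

instance (k : ℕ) : Module ℝ (Form V M k) := inferInstanceAs (Module ℝ (formSubmodule V M k))

variable (V M) in
/-- Smooth vector fields on `M`. -/
structure VectorField where
  /-- The underlying section of the tangent bundle. -/
  toFun : ∀ x : M, TangentSpace 𝓘(ℝ, V) x
  smooth : ∀ x₀, ContDiffOn ℝ ∞ (vectorInChart toFun x₀) (chartAt V x₀).target

variable (V M) in
/-- Smooth bivector fields on `M`, a bivector at `x` being an alternating bilinear form
on `T_x^* M`. -/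
structure BivectorField where
  /-- The underlying section of `⋀² T M`. -/
  toFun : ∀ x : M, (TangentSpace 𝓘(ℝ, V) x →L[ℝ] ℝ) [⋀^Fin 2]→L[ℝ] ℝ
  smooth : ∀ x₀, ContDiffOn ℝ ∞ (bivectorInChart toFun x₀) (chartAt V x₀).target

/-- The exterior derivative, computed at `x` in the chart around `x`. -/
def extDerivFun (a : ∀ x : M, TangentSpace 𝓘(ℝ, V) x [⋀^Fin k]→L[ℝ] ℝ) (x : M) :
    TangentSpace 𝓘(ℝ, V) x [⋀^Fin (k + 1)]→L[ℝ] ℝ :=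
  (extDeriv (formInChart a x) (chartAt V x x)).compContinuousLinearMap (chartPush x x)

theorem formInChart_wedgeLeft (a : ∀ x : M, TangentSpace 𝓘(ℝ, V) x [⋀^Fin 1]→L[ℝ] ℝ)
    (b : ∀ x : M, TangentSpace 𝓘(ℝ, V) x [⋀^Fin k]→L[ℝ] ℝ) (x₀ : M) (y : V) :
    formInChart (fun x => wedgeLeft (V := V) (a x) (b x)) x₀ y =
      wedgeLeft (formInChart a x₀ y) (formInChart b x₀ y) :=
  (wedgeLeft_comp (V := V) _ _ _).symm

section Lemmas

variable [IsManifold 𝓘(ℝ, V) ∞ M]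

theorem chartPush_comp_chartPull (x₀ : M) {y : V} (hy : y ∈ (chartAt V x₀).target) :
    (chartPush x₀ ((chartAt V x₀).symm y) : V →L[ℝ] V) ∘L (chartPull x₀ y : V →L[ℝ] V) =
      .id ℝ V :=
  (mdifferentiable_chart (I := 𝓘(ℝ, V)) x₀).comp_symm_deriv hy

theorem chartPull_comp_chartPush (x₀ : M) {y : V} (hy : y ∈ (chartAt V x₀).target) :
    (chartPull x₀ y : V →L[ℝ] V) ∘L (chartPush x₀ ((chartAt V x₀).symm y) : V →L[ℝ] V) =
      .id ℝ V := by
  have := (mdifferentiable_chart (I := 𝓘(ℝ, V)) x₀).symm_comp_deriv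
    ((chartAt V x₀).map_target hy)
  rw [(chartAt V x₀).right_inv hy] at this
  exact this

theorem formInChart_comp_chartPush (a : ∀ x : M, TangentSpace 𝓘(ℝ, V) x [⋀^Fin k]→L[ℝ] ℝ)
    (x₀ : M) {z : M} (hz : z ∈ (chartAt V x₀).source) :
    (formInChart a x₀ (chartAt V x₀ z)).compContinuousLinearMap (chartPush x₀ z : V →L[ℝ] V) =
      a z := by
  have h1 := (mdifferentiable_chart (I := 𝓘(ℝ, V)) x₀).symm_comp_deriv hz
  have h2 : ∀ v : V, (chartPull x₀ (chartAt V x₀ z) : V →L[ℝ] V)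
      ((chartPush x₀ z : V →L[ℝ] V) v) = v := fun v => DFunLike.congr_fun h1 v
  let a' : M → V [⋀^Fin k]→L[ℝ] ℝ := a
  have h3 : (a ((chartAt V x₀).symm (chartAt V x₀ z)) : V [⋀^Fin k]→L[ℝ] ℝ) = a z :=
    congrArg a' ((chartAt V x₀).left_inv hz)
  refine ContinuousAlternatingMap.ext fun v => ?_
  change (a ((chartAt V x₀).symm (chartAt V x₀ z)) : V [⋀^Fin k]→L[ℝ] ℝ)
    (fun i => (chartPull x₀ (chartAt V x₀ z) : V →L[ℝ] V)
      ((chartPush x₀ z : V →L[ℝ] V) (v i))) = (a z : V [⋀^Fin k]→L[ℝ] ℝ) v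
  have h4 : ∀ (c c' : V [⋀^Fin k]→L[ℝ] ℝ) (u u' : Fin k → V), c = c' → u = u' → c u = c' u' := by
    rintro c _ u _ rfl rfl
    rfl
  exact h4 _ _ _ _ h3 (funext fun i => h2 (v i))

/-- In every chart the exterior derivative is the exterior derivative of the chart expression. -/
theorem formInChart_extDerivFun (a : Form V M k) (x₀ : M) {y : V}
    (hy : y ∈ (chartAt V x₀).target) :
    formInChart (extDerivFun a.1) x₀ y = extDeriv (formInChart a.1 x₀) y := by
  set x := (chartAt V x₀).symm y with hx
  set τ : V → V := fun y' => chartAt V x ((chartAt V x₀).symm y') with hτ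
  have hN : (chartAt V x₀).target ∩ (chartAt V x₀).symm ⁻¹' (chartAt V x).source ∈ nhds y :=
    ((chartAt V x₀).continuousOn_symm.isOpen_inter_preimage (chartAt V x₀).open_target
      (chartAt V x).open_source).mem_nhds ⟨hy, mem_chart_source V x⟩
  have hfd : ∀ y' ∈ (chartAt V x₀).target ∩ (chartAt V x₀).symm ⁻¹' (chartAt V x).source,
      fderiv ℝ τ y' = (chartPush x ((chartAt V x₀).symm y') : V →L[ℝ] V) ∘L
        (chartPull x₀ y' : V →L[ℝ] V) := by
    intro y' hy'
    rw [← mfderiv_eq_fderiv]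
    exact mfderiv_comp (I := 𝓘(ℝ, V)) (I' := 𝓘(ℝ, V)) (I'' := 𝓘(ℝ, V)) y'
      ((mdifferentiable_chart (I := 𝓘(ℝ, V)) x).mdifferentiableAt hy'.2)
      ((mdifferentiable_chart (I := 𝓘(ℝ, V)) x₀).mdifferentiableAt_symm hy'.1)
  have hform : formInChart a.1 x₀ =ᶠ[nhds y]
      fun y' => (formInChart a.1 x (τ y')).compContinuousLinearMap (fderiv ℝ τ y') := by
    filter_upwards [hN] with y' hy'
    rw [hfd y' hy']
    have := formInChart_comp_chartPush a.1 x hy'.2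
    refine ContinuousAlternatingMap.ext fun v => ?_
    exact (DFunLike.congr_fun this (fun i => (chartPull x₀ y' : V →L[ℝ] V) (v i))).symm
  have hτd : ContDiffAt ℝ ∞ τ y := by
    rw [← contMDiffAt_iff_contDiffAt]
    have h1 : ContMDiffAt 𝓘(ℝ, V) 𝓘(ℝ, V) ∞ (chartAt V x) ((chartAt V x₀).symm y) :=
      (contMDiffOn_chart (I := 𝓘(ℝ, V)) (n := ∞) (x := x)).contMDiffAt
        ((chartAt V x).open_source.mem_nhds (mem_chart_source V x))
    have h2 : ContMDiffAt 𝓘(ℝ, V) 𝓘(ℝ, V) ∞ (chartAt V x₀).symm y :=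
      (contMDiffOn_chart_symm (I := 𝓘(ℝ, V)) (n := ∞) (x := x₀)).contMDiffAt
        ((chartAt V x₀).open_target.mem_nhds hy)
    exact h1.comp y h2
  have hdiff : DifferentiableAt ℝ (formInChart a.1 x) (τ y) :=
    ((a.2 x).contDiffAt ((chartAt V x).open_target.mem_nhds
      ((chartAt V x).map_source (mem_chart_source V x)))).differentiableAt (by simp)
  rw [hform.extDeriv_eq, extDeriv_pullback hdiff hτd
    (by simpa using WithTop.coe_le_coe.2 (le_top : (2 : ℕ∞) ≤ ⊤)), hfd y ⟨hy, mem_chart_source V x⟩]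
  rfl

theorem formInChart_curryLeft (a : ∀ x : M, TangentSpace 𝓘(ℝ, V) x [⋀^Fin (k + 1)]→L[ℝ] ℝ)
    (X : ∀ x : M, TangentSpace 𝓘(ℝ, V) x) (x₀ : M) {y : V} (hy : y ∈ (chartAt V x₀).target) :
    formInChart (fun x => ContinuousAlternatingMap.curryLeft (E := V) (a x) (X x)) x₀ y =
      (formInChart a x₀ y).curryLeft (vectorInChart X x₀ y) := by
  have h := DFunLike.congr_fun (chartPull_comp_chartPush x₀ hy) (X ((chartAt V x₀).symm y))
  have h' : (chartPull x₀ y : V →L[ℝ] V) (vectorInChart X x₀ y) = X ((chartAt V x₀).symm y) := h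
  have key : ∀ (c : V [⋀^Fin (k + 1)]→L[ℝ] ℝ) (A : V →L[ℝ] V) (u u' : V), A u = u' →
      (c.curryLeft u').compContinuousLinearMap A = (c.compContinuousLinearMap A).curryLeft u := by
    rintro c A u _ rfl
    exact (ContinuousAlternatingMap.curryLeft_compContinuousLinearMap _ _ _).symm
  exact key _ _ _ _ h'

theorem formInChart_contract [FiniteDimensional ℝ V]
    (P : ∀ x : M, (TangentSpace 𝓘(ℝ, V) x →L[ℝ] ℝ) [⋀^Fin 2]→L[ℝ] ℝ)
    (a : ∀ x : M, TangentSpace 𝓘(ℝ, V) x [⋀^Fin (k + 2)]→L[ℝ] ℝ)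
    (x₀ : M) {y : V} (hy : y ∈ (chartAt V x₀).target) :
    formInChart (fun x => contract (V := V) (P x) (a x)) x₀ y =
      contract (bivectorInChart P x₀ y) (formInChart a x₀ y) :=
  (contract_comp (V := V) _ _ (chartPull_comp_chartPush x₀ hy)).symm

end Lemmas

/-! ### Operators on differential forms -/

section Operators

variable [IsManifold 𝓘(ℝ, V) ∞ M]

variable (V M) in
/-- The exterior derivative `d : Ω^k(M) → Ω^{k+1}(M)`. -/
def extD (k : ℕ) : Form V M k →ₗ[ℝ] Form V M (k + 1) where
  toFun a := ⟨extDerivFun a.1, fun x₀ => by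
    have h : ContDiffOn ℝ ∞ (extDeriv (formInChart a.1 x₀)) (chartAt V x₀).target := by
      have := (a.2 x₀).fderiv_of_isOpen (m := ∞) (chartAt V x₀).open_target (by simp)
      exact contDiffOn_const.clm_apply
        (f := fun _ => ContinuousAlternatingMap.alternatizeUncurryFinCLM ℝ V ℝ) this
    exact h.congr fun y hy => formInChart_extDerivFun a x₀ hy⟩
  map_add' a b := by
    refine Subtype.ext (funext fun x => ?_)
    have hx := (chartAt V x).open_target.mem_nhds
      ((chartAt V x).map_source (mem_chart_source V x))
    have ha := ((a.2 x).contDiffAt hx).differentiableAt (by simp)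
    have hb := ((b.2 x).contDiffAt hx).differentiableAt (by simp)
    have := extDeriv_add ha hb
    exact congrArg (fun f : V [⋀^Fin (k + 1)]→L[ℝ] ℝ =>
      f.compContinuousLinearMap (chartPush x x : V →L[ℝ] V)) this
  map_smul' c a := by
    refine Subtype.ext (funext fun x => ?_)
    have := extDeriv_smul (x := chartAt V x x) c (formInChart a.1 x)
    exact congrArg (fun f : V [⋀^Fin (k + 1)]→L[ℝ] ℝ =>
      f.compContinuousLinearMap (chartPush x x : V →L[ℝ] V)) this

/-- The exterior multiplication `e(η) : Ω^k(M) → Ω^{k+1}(M)`, `a ↦ η ∧ a`, by a `1`-form. -/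
def extMul (η : Form V M 1) (k : ℕ) : Form V M k →ₗ[ℝ] Form V M (k + 1) where
  toFun a := ⟨fun x => wedgeLeft (V := V) (η.1 x) (a.1 x), fun x₀ =>
    (contDiffOn_wedgeLeft (η.2 x₀) (a.2 x₀)).congr fun y _ => formInChart_wedgeLeft η.1 a.1 x₀ y⟩
  map_add' a b := Subtype.ext (funext fun x => wedgeLeft_add (V := V) (η.1 x) (a.1 x) (b.1 x))
  map_smul' c a := Subtype.ext (funext fun x => wedgeLeft_smul (V := V) c (η.1 x) (a.1 x))

/-- The interior product `i_X : Ω^{k+1}(M) → Ω^k(M)`, `(i_X a) (v₁, …) = a (X, v₁, …)`. -/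
def interior (X : VectorField V M) (k : ℕ) : Form V M (k + 1) →ₗ[ℝ] Form V M k where
  toFun a := ⟨fun x => ContinuousAlternatingMap.curryLeft (E := V) (a.1 x) (X.1 x), fun x₀ =>
    (contDiffOn_curryLeft (a.2 x₀) (X.2 x₀)).congr fun _ hy => formInChart_curryLeft a.1 X.1 x₀ hy⟩
  map_add' _ _ := rfl
  map_smul' _ _ := rfl

/-- The contraction `i(P) : Ω^{k+2}(M) → Ω^k(M)` by a bivector field `P`. -/
def contraction [FiniteDimensional ℝ V] (P : BivectorField V M) (k : ℕ) :
    Form V M (k + 2) →ₗ[ℝ] Form V M k where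
  toFun a := ⟨fun x => contract (V := V) (P.1 x) (a.1 x), fun x₀ =>
    (contDiffOn_contract (P.2 x₀) (a.2 x₀)).congr fun _ hy => formInChart_contract P.1 a.1 x₀ hy⟩
  map_add' a b := Subtype.ext (funext fun x => contract_add (V := V) (P.1 x) (a.1 x) (b.1 x))
  map_smul' c a := Subtype.ext (funext fun x => contract_smul (V := V) c (P.1 x) (a.1 x))

/-- The Lie derivative `L_X = i_X d + d i_X : Ω^k(M) → Ω^k(M)` (with `i_X = 0` on functions). -/
def lieDeriv (X : VectorField V M) : (k : ℕ) → Form V M k →ₗ[ℝ] Form V M k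
  | 0 => interior X 0 ∘ₗ extD V M 0
  | k + 1 => interior X (k + 1) ∘ₗ extD V M (k + 1) + extD V M k ∘ₗ interior X k

/-- The operator `i(P) d - d i(P) : Ω^{k+1}(M) → Ω^k(M)` (with `i(P) = 0` on `1`-forms). -/
def koszul [FiniteDimensional ℝ V] (P : BivectorField V M) :
    (k : ℕ) → Form V M (k + 1) →ₗ[ℝ] Form V M k
  | 0 => contraction P 0 ∘ₗ extD V M 1
  | k + 1 => contraction P (k + 1) ∘ₗ extD V M (k + 2) - extD V M k ∘ₗ contraction P k

end Operators

/-! ### The Lichnerowicz-Jacobi complex of a pair `(Λ, E)` -/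

section Complex

variable (V M) in
/-- The space of chains `Ω^k(M) ⊕ Ω^{k-1}(M)`, with `Ω^{-1}(M) = 0`. -/
def Chain : ℕ → Type _
  | 0 => Form V M 0
  | k + 1 => Form V M (k + 1) × Form V M k

instance : (k : ℕ) → AddCommGroup (Chain V M k)
  | 0 => inferInstanceAs (AddCommGroup (Form V M 0))
  | k + 1 => inferInstanceAs (AddCommGroup (Form V M (k + 1) × Form V M k))

instance : (k : ℕ) → Module ℝ (Chain V M k)
  | 0 => inferInstanceAs (Module ℝ (Form V M 0))
  | k + 1 => inferInstanceAs (Module ℝ (Form V M (k + 1) × Form V M k))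

/-- The map `(α, β) ↦ (η ∧ α, η ∧ β)` from chains of degree `k` to chains of degree `k + 1`. -/
def extMulChain (η : Form V M 1) : (k : ℕ) → Chain V M k →ₗ[ℝ] Chain V M (k + 1)
  | 0 => (extMul η 0).prod (0 : Form V M 0 →ₗ[ℝ] Form V M 0)
  | k + 1 => (extMul η (k + 1)).prodMap (extMul η k)

variable [IsManifold 𝓘(ℝ, V) ∞ M] [FiniteDimensional ℝ V]

/-- The first component of the boundary of `(α, β) ∈ Ω^r(M) ⊕ Ω^{r-1}(M)` for `r = k + 1`:
`i(Λ) d α - d i(Λ) α + r i_E α + (-1)^r L_E β`. -/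
def boundaryFst (L : BivectorField V M) (E : VectorField V M) (k : ℕ) :
    Form V M (k + 1) × Form V M k →ₗ[ℝ] Form V M k :=
  (koszul L k + ((k + 1 : ℕ) : ℝ) • interior E k) ∘ₗ LinearMap.fst ℝ _ _ +
    ((-1 : ℝ) ^ (k + 1) • lieDeriv E k) ∘ₗ LinearMap.snd ℝ _ _

/-- The second component of the boundary of `(α, β) ∈ Ω^r(M) ⊕ Ω^{r-1}(M)` for `r = k + 2`:
`i(Λ) d β - d i(Λ) β + (r - 1) i_E β + (-1)^r i(Λ) α`. -/
def boundarySnd (L : BivectorField V M) (E : VectorField V M) (k : ℕ) :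
    Form V M (k + 2) × Form V M (k + 1) →ₗ[ℝ] Form V M k :=
  (koszul L k + ((k + 1 : ℕ) : ℝ) • interior E k) ∘ₗ LinearMap.snd ℝ _ _ +
    ((-1 : ℝ) ^ (k + 2) • contraction L k) ∘ₗ LinearMap.fst ℝ _ _

/-- The boundary operator
`δ : Ω^{k+1}(M) ⊕ Ω^k(M) → Ω^k(M) ⊕ Ω^{k-1}(M)`. -/
def boundary (L : BivectorField V M) (E : VectorField V M) :
    (k : ℕ) → Chain V M (k + 1) →ₗ[ℝ] Chain V M k
  | 0 => boundaryFst L E 0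
  | k + 1 => (boundaryFst L E (k + 1)).prod (boundarySnd L E k)

/-- The cycles of degree `k`: the kernel of `δ` on chains of degree `k`
(all chains in degree `0`, where `δ` has target `0`). -/
def cycles (L : BivectorField V M) (E : VectorField V M) : (k : ℕ) → Submodule ℝ (Chain V M k)
  | 0 => ⊤
  | k + 1 => LinearMap.ker (boundary L E k)

/-- The `k`-th Lichnerowicz-Jacobi homology space: cycles of degree `k` modulo boundaries. -/
abbrev Homology (L : BivectorField V M) (E : VectorField V M) (k : ℕ) : Type _ :=
  cycles L E k ⧸ (LinearMap.range (boundary L E k)).submoduleOf (cycles L E k)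

end Complex

/-! ### Contact manifolds -/

section Contact

variable [IsManifold 𝓘(ℝ, V) ∞ M]

/-- `η` is a contact `1`-form: `dim M = 2 m + 1` and `η ∧ (dη)^m ≠ 0` at every point. -/
def IsContact (m : ℕ) (η : Form V M 1) : Prop :=
  Module.finrank ℝ V = 2 * m + 1 ∧
    ∀ x, wedge (V := V) (η.1 x).toAlternatingMap
      (wedgePow (V := V) ((extD V M 1 η).1 x).toAlternatingMap m) ≠ 0

/-- The map `♭ : T_x M → T_x^* M`, `♭ X = i_X dη + η(X) η`. -/
def contactFlat (η : Form V M 1) (x : M) :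
    TangentSpace 𝓘(ℝ, V) x →L[ℝ] (TangentSpace 𝓘(ℝ, V) x →L[ℝ] ℝ) :=
  flat (V := V) (η.1 x) ((extD V M 1 η).1 x)

variable [FiniteDimensional ℝ V] {m : ℕ} {η : Form V M 1}

theorem IsContact.isInvertible (h : IsContact m η) (x : M) :
    (flat (V := V) (η.1 x) ((extD V M 1 η).1 x)).IsInvertible :=
  flat_isInvertible h.1 (h.2 x)

theorem IsContact.contDiffOn_inverse (h : IsContact m η) (x₀ : M) :
    ContDiffOn ℝ ∞ (fun y => (flat (formInChart η.1 x₀ y)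
      (formInChart (extD V M 1 η).1 x₀ y)).inverse) (chartAt V x₀).target :=
  contDiffOn_flat_inverse (η.2 x₀) ((extD V M 1 η).2 x₀) fun _ hy =>
    flat_isInvertible_comp (V := V) (chartPull_comp_chartPush x₀ hy)
      (chartPush_comp_chartPull x₀ hy) (h.isInvertible _)

/-- The vector field `E = ♭⁻¹ η` of a contact form (the Reeb vector field). -/
def IsContact.reeb (h : IsContact m η) : VectorField V M where
  toFun x := (contactFlat η x).inverse (covec (V := V) (η.1 x))
  smooth x₀ := by
    refine ((h.contDiffOn_inverse x₀).clm_apply (contDiffOn_covec (η.2 x₀))).congr fun y hy => ?_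
    have h1 := flat_inverse_comp (V := V) (chartPull_comp_chartPush x₀ hy)
      (chartPush_comp_chartPull x₀ hy) (h.isInvertible ((chartAt V x₀).symm y))
    have key : ∀ (a : V [⋀^Fin 1]→L[ℝ] ℝ) (A B : V →L[ℝ] V) (_ : A ∘L B = .id ℝ V)
        (F : (V →L[ℝ] ℝ) →L[ℝ] V) (F' : (V →L[ℝ] ℝ) →L[ℝ] V) (_ : F' = B ∘L F ∘L B.precomp ℝ),
        B (F (covec a)) = F' (covec (a.compContinuousLinearMap A)) := by
      rintro a A B hAB F _ rfl
      rw [← covec_comp_comp hAB a]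
      rfl
    exact key _ _ _ (chartPull_comp_chartPush x₀ hy) _ _ h1

/-- The bivector field `Λ(α, β) = dη(♭⁻¹ α, ♭⁻¹ β)` of a contact form. -/
def IsContact.bivector (h : IsContact m η) : BivectorField V M where
  toFun x := ((extD V M 1 η).1 x).compContinuousLinearMap (contactFlat η x).inverse
  smooth x₀ := by
    refine (contDiffOn_comp_two ((extD V M 1 η).2 x₀) (h.contDiffOn_inverse x₀)).congr
      fun y hy => ?_
    have h1 := flat_inverse_comp (V := V) (chartPull_comp_chartPush x₀ hy)
      (chartPush_comp_chartPull x₀ hy) (h.isInvertible ((chartAt V x₀).symm y))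
    have key : ∀ (w : V [⋀^Fin 2]→L[ℝ] ℝ) (A B : V →L[ℝ] V) (_ : A ∘L B = .id ℝ V)
        (F : (V →L[ℝ] ℝ) →L[ℝ] V) (F' : (V →L[ℝ] ℝ) →L[ℝ] V) (_ : F' = B ∘L F ∘L B.precomp ℝ),
        (w.compContinuousLinearMap F).compContinuousLinearMap (B.precomp ℝ) =
          (w.compContinuousLinearMap A).compContinuousLinearMap F' := by
      rintro w A B hAB F _ rfl
      have hAB' : ∀ v, A (B v) = v := fun v => DFunLike.congr_fun hAB v
      ext c
      simp [Function.comp_def, hAB']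
    exact key _ _ _ (chartPull_comp_chartPush x₀ hy) _ _ h1

end Contact

end Manifold

end LJ

end

open LJ

open LJ

noncomputable section

/-! Write D, e, i, L and N for the exterior derivative, multiplication by η, contraction by the Reeb
field E, contraction by Λ and the degree operator, all acting on families of forms of every degree.
Put K = LD − DL, ℓ = Di + iD, and W = De + eD, which is multiplication by dη.

Multiplication by η is, up to a constant, a contracting homotopy: δe + eδ = m + 1. The source of the
constant is the horizontal Lefschetz relation LW − WL = H with H = m − N + ei. As L commutes with e,
it gives Ke + eK = H (`koszul_e`). On a k-form the terms in i_E contribute (k+1)ie + k ei = k + 1 −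
ei, and adding H leaves m + 1. The other terms of δ, built from ℓ and L, commute with e and carry
opposite signs in consecutive degrees, so they cancel. On a cycle this becomes δ(ec) = (m + 1)c, and
the homology vanishes.

For δ² = 0 one needs that (Λ, E) is a Jacobi structure: Lℓ = ℓL (invariance of Λ) and KL − LK = 2iL
(the identity [Λ, Λ] = 2 E ∧ Λ). No Schouten bracket is computed. The Lefschetz relation makes (L,
H, W) an sl₂-triple; under the adjoint action ℓ has weight 0 and the horizontal part D − eℓ − Wi of
the derivative has weight −1, and both commute with W. Since L is nilpotent, `ad_pow_apply_eq_zero`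
shows that ad L kills the first and (ad L)² the second, which yields both identities.

The inputs are pointwise, except those on D. At a point the relations follow from the
anticommutation rules of covectors and vectors and from the linear algebra of ♭
(`HorizontalInverse.pointRelations`, `horizontalInverse`). D enters only through its degree, D² = 0
and the Leibniz rule, which makes De + eD tensorial (`evalAll_extD_extMul`). -/

namespace LJ

/-! ### Algebraic consequences of the commutation relations on a contact manifold -/

section Algebra

variable {A : Type*} [Ring A] [Algebra ℝ A]

attribute [local instance] LieRing.ofAssociativeRing LieAlgebra.ofAssociativeAlgebra

/-- A vector of weight `-n` in the adjoint representation of an `sl₂`-triple `(Λ, H, W)` that is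
annihilated by `W` is annihilated by the `(n + 1)`-st power of `Λ`, if `Λ` is nilpotent. -/
theorem ad_pow_apply_eq_zero {W L H X : A} (hLW : ⁅L, W⁆ = H) (hHL : ⁅H, L⁆ = (2 : ℝ) • L)
    (hWX : ⁅W, X⁆ = 0) {n : ℕ} (hHX : ⁅H, X⁆ = (-n : ℝ) • X) (hL : IsNilpotent L) :
    (LieAlgebra.ad ℝ A L ^ (n + 1)) X = 0 := by
  set F := LieAlgebra.ad ℝ A L with hF
  have hsucc : ∀ j, (F ^ (j + 1)) X = ⁅L, (F ^ j) X⁆ := fun j => by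
    rw [pow_succ', Module.End.mul_apply, hF, LieAlgebra.ad_apply]
  have hH : ∀ j : ℕ, ⁅H, (F ^ j) X⁆ = (-n + 2 * j : ℝ) • (F ^ j) X := by
    intro j
    induction j with
    | zero => simpa using hHX
    | succ j ih =>
      rw [hsucc, leibniz_lie, hHL, ih, smul_lie, lie_smul, ← add_smul]
      push_cast
      ring_nf
  -- The usual sl₂ string: moving W past a factor ad L costs −H, and the negated weights n − 2t for
  -- t ≤ j sum to (j + 1)(n − j).
  have hW : ∀ j : ℕ, ⁅W, (F ^ (j + 1)) X⁆ = ((j + 1) * (n - j) : ℝ) • (F ^ j) X := by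
    intro j
    induction j with
    | zero =>
      rw [hsucc, leibniz_lie, ← lie_skew W L, hLW, neg_lie, hH, pow_zero, Module.End.one_apply, hWX,
        lie_zero, ← neg_smul]
      simp
    | succ j ih =>
      rw [hsucc (j + 1), leibniz_lie, ← lie_skew W L, hLW, neg_lie, hH, ih, lie_smul, ← hsucc,
        ← neg_smul, ← add_smul]
      push_cast
      ring_nf
  obtain ⟨p, hp⟩ := LieAlgebra.ad_nilpotent_of_nilpotent (R := ℝ) hL
  -- For j > n the coefficient (j + 1)(n − j) is nonzero, so applying W turns the vanishing of a
  -- power into the vanishing of the one below, down to n + 1.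
  have hdesc : ∀ q, (F ^ (n + 1 + q)) X = 0 → (F ^ (n + 1)) X = 0 := by
    intro q
    induction q with
    | zero => exact id
    | succ q ih =>
      intro h
      refine ih ?_
      have h1 := hW (n + 1 + q)
      rw [show n + 1 + q + 1 = n + 1 + (q + 1) by ring, h, lie_zero] at h1
      refine (smul_eq_zero.1 h1.symm).resolve_left (mul_ne_zero (by positivity) ?_)
      push_cast
      have : (0 : ℝ) ≤ q := q.cast_nonneg
      linarith
  refine hdesc p ?_
  rw [pow_add, hp, mul_zero, LinearMap.zero_apply]

/-- The relations between the exterior derivative `D`, the exterior multiplication `e` by the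
contact form, the interior product `i` by the Reeb field, the contraction `L` by the bivector and
the degree operator `N`. -/
structure ContactRelations (m : ℝ) (D e i L N : A) : Prop where
  D_D : D * D = 0
  e_e : e * e = 0
  i_i : i * i = 0
  i_e : i * e = 1 - e * i
  L_e : L * e = e * L
  L_i : L * i = i * L
  comm_i : (D * e + e * D) * i = i * (D * e + e * D)
  L_comm : L * (D * e + e * D) - (D * e + e * D) * L = algebraMap ℝ A m - N + e * i
  N_D : N * D = D * N + D
  N_L : N * L = L * N - 2 * L
  N_e : N * e = e * N + e
  N_i : N * i = i * N - i
  nilpotent : IsNilpotent L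

/-! ### Weights for the sl₂-triple and the Jacobi structure identities -/

namespace ContactRelations

variable {m : ℝ} {D e i L N : A}

/-- Because ie + ei = 1, the commutators ℓe − eℓ and iW − Wi are equal, and the second vanishes.
Geometrically, the Reeb flow preserves η. -/
theorem lie_e (h : ContactRelations m D e i L N) :
    (D * i + i * D) * e = e * (D * i + i * D) := by
  have h1 := h.i_e
  have h2 := h.comm_i
  linear_combination (norm := noncomm_ring) D * h1 - h2 - h1 * D

theorem lie_i (h : ContactRelations m D e i L N) :
    (D * i + i * D) * i = i * (D * i + i * D) := by
  have h1 := h.i_i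
  linear_combination (norm := noncomm_ring) D * h1 - h1 * D

theorem lie_D (h : ContactRelations m D e i L N) :
    (D * i + i * D) * D = D * (D * i + i * D) := by
  have h1 := h.D_D
  linear_combination (norm := noncomm_ring) i * h1 - h1 * i

theorem comm_D (h : ContactRelations m D e i L N) :
    (D * e + e * D) * D = D * (D * e + e * D) := by
  have h1 := h.D_D
  linear_combination (norm := noncomm_ring) e * h1 - h1 * e

theorem comm_e (h : ContactRelations m D e i L N) :
    (D * e + e * D) * e = e * (D * e + e * D) := by
  have h1 := h.e_e
  linear_combination (norm := noncomm_ring) D * h1 - h1 * D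

/-- W commutes with both D and i, hence with ℓ; this is the annihilation hypothesis of
`ad_pow_apply_eq_zero` for X = ℓ. -/
theorem comm_lie (h : ContactRelations m D e i L N) :
    (D * e + e * D) * (D * i + i * D) = (D * i + i * D) * (D * e + e * D) := by
  have h1 := h.comm_D
  have h2 := h.comm_i
  generalize D * e + e * D = W at *
  linear_combination (norm := noncomm_ring) h1 * i + D * h2 + h2 * D + i * h1

theorem N_lie (h : ContactRelations m D e i L N) :
    N * (D * i + i * D) = (D * i + i * D) * N := by
  have h1 := h.N_D
  have h2 := h.N_i
  linear_combination (norm := noncomm_ring) h1 * i + D * h2 + h2 * D + i * h1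

theorem N_comm (h : ContactRelations m D e i L N) :
    N * (D * e + e * D) = (D * e + e * D) * N + 2 * (D * e + e * D) := by
  have h1 := h.N_D
  have h2 := h.N_e
  linear_combination (norm := noncomm_ring) h1 * e + D * h2 + h2 * D + e * h1

/-- The contraction `L` has weight `2` for the weight operator `H = m - N + e i`. -/
theorem weight_L (h : ContactRelations m D e i L N) :
    ⁅algebraMap ℝ A m - N + e * i, L⁆ = (2 : ℝ) • L := by
  have h1 := h.N_L
  have h2 := h.L_e
  have h3 := h.L_i
  have h4 := Algebra.commutes m L
  rw [Ring.lie_def, ofNat_smul_eq_nsmul ℝ 2 L]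
  linear_combination (norm := noncomm_ring) h4 - h1 - h2 * i - e * h3

theorem weight_comm (h : ContactRelations m D e i L N) :
    ⁅algebraMap ℝ A m - N + e * i, D * e + e * D⁆ = -(2 : ℝ) • (D * e + e * D) := by
  have h1 := h.N_comm
  have h2 := h.comm_e
  have h3 := h.comm_i
  generalize D * e + e * D = W at *
  have h4 := Algebra.commutes m W
  rw [Ring.lie_def, neg_smul, ofNat_smul_eq_nsmul ℝ 2 W]
  linear_combination (norm := noncomm_ring) h4 - h1 - h2 * i - e * h3

/-- ℓ preserves the degree and commutes with e and i, so it has weight 0. -/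
theorem weight_lie (h : ContactRelations m D e i L N) :
    (algebraMap ℝ A m - N + e * i) * (D * i + i * D) =
      (D * i + i * D) * (algebraMap ℝ A m - N + e * i) := by
  have h1 := h.N_lie
  have h2 := h.lie_e
  have h3 := h.lie_i
  generalize D * i + i * D = l at *
  have h4 := Algebra.commutes m l
  linear_combination (norm := noncomm_ring) h4 - h1 - h2 * i - e * h3

theorem weight_e (h : ContactRelations m D e i L N) :
    (algebraMap ℝ A m - N + e * i) * e = e * (algebraMap ℝ A m - N + e * i) := by
  have h1 := h.N_e
  have h2 := h.i_e
  have h3 := h.e_e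
  have h4 := Algebra.commutes m e
  linear_combination (norm := noncomm_ring) h4 - h1 + e * h2 - 2 * h3 * i

theorem weight_i (h : ContactRelations m D e i L N) :
    (algebraMap ℝ A m - N + e * i) * i = i * (algebraMap ℝ A m - N + e * i) := by
  have h1 := h.N_i
  have h2 := h.i_e
  have h3 := h.i_i
  have h4 := Algebra.commutes m i
  linear_combination (norm := noncomm_ring) h4 - h1 - h2 * i + 2 * e * h3

/-- The bivector is invariant under the Reeb flow. -/
theorem L_lie (h : ContactRelations m D e i L N) :
    L * (D * i + i * D) = (D * i + i * D) * L := by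
  -- Weight 0 is the case n = 0, so the first power of ad L already kills ℓ.
  have := ad_pow_apply_eq_zero (X := D * i + i * D) (n := 0) h.L_comm h.weight_L
    (by rw [Ring.lie_def, h.comm_lie, sub_self])
    (by rw [Ring.lie_def, h.weight_lie, sub_self]; simp) h.nilpotent
  rw [zero_add, pow_one, LieAlgebra.ad_apply, Ring.lie_def] at this
  exact sub_eq_zero.1 this

/-- The horizontal component `D - e ℓ - W i` of the exterior derivative, where `ℓ = D i + i D` and
`W = D e + e D`, has weight `-1`. -/
theorem weight_horizontal (h : ContactRelations m D e i L N) :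
    ⁅algebraMap ℝ A m - N + e * i, D - e * (D * i + i * D) - (D * e + e * D) * i⁆ =
      -(D - e * (D * i + i * D) - (D * e + e * D) * i) := by
  have h1 := h.weight_e
  have h2 := h.weight_lie
  have h3 := h.weight_comm
  have h4 := h.weight_i
  have h5 : ⁅algebraMap ℝ A m - N + e * i, D⁆ = -D + e * (D * i + i * D) - (D * e + e * D) * i := by
    have h6 := h.N_D
    have h7 := Algebra.commutes m D
    rw [Ring.lie_def]
    linear_combination (norm := noncomm_ring) h7 - h6
  rw [Ring.lie_def] at *
  rw [neg_smul, ofNat_smul_eq_nsmul ℝ 2] at h3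
  generalize algebraMap ℝ A m - N + e * i = H at *
  generalize D * i + i * D = l at *
  generalize D * e + e * D = W at *
  linear_combination (norm := noncomm_ring) h5 - h1 * l - e * h2 - h3 * i - W * h4

/-- The Jacobi identity `[Λ, Λ] = 2 E ∧ Λ` in operator form. -/
theorem koszul_L (h : ContactRelations m D e i L N) :
    (L * D - D * L) * L - L * (L * D - D * L) = 2 * (i * L) := by
  have h0 : ∀ X : A, (LieAlgebra.ad ℝ A L ^ 2) X = L * (L * X - X * L) - (L * X - X * L) * L :=
    fun X => rfl
  have h1 := ad_pow_apply_eq_zero (X := D - e * (D * i + i * D) - (D * e + e * D) * i) (n := 1)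
    h.L_comm h.weight_L ?_ (by rw [h.weight_horizontal]; simp) h.nilpotent
  · rw [h0] at h1
    have h2 := h.L_lie
    have h3 := h.L_comm
    have h4 := h.L_e
    have h5 := h.L_i
    have h6 := h.weight_L
    rw [Ring.lie_def, ofNat_smul_eq_nsmul ℝ 2 L] at h6
    generalize algebraMap ℝ A m - N + e * i = H at *
    generalize D * i + i * D = l at *
    generalize D * e + e * D = W at *
    -- Of the three parts of D, the horizontal one is killed by (ad L)², the part eℓ commutes with
    -- L, and Wi has bracket Hi with L. Hence [L, [L, D]] = [L, Hi] = −2iL.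
    have h7 : L * (e * l) - e * l * L = 0 := by
      linear_combination (norm := noncomm_ring) h4 * l + e * h2
    have h8 : L * (W * i) - W * i * L = H * i := by
      linear_combination (norm := noncomm_ring) h3 * i + W * h5
    have h9 : L * (L * D - D * L) - (L * D - D * L) * L = L * (H * i) - H * i * L := by
      linear_combination (norm := noncomm_ring) h1 + L * h7 - h7 * L + L * h8 - h8 * L
    linear_combination (norm := noncomm_ring) -h9 + h6 * i - H * h5 + 2 * h5
  -- The remaining obligation: each summand of the horizontal part commutes with W.
  · have h2 := h.comm_e
    have h3 := h.comm_i
    have h4 := h.comm_lie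
    have h5 := h.comm_D
    rw [Ring.lie_def]
    generalize D * i + i * D = l at *
    generalize D * e + e * D = W at *
    linear_combination (norm := noncomm_ring) h5 - h2 * l - e * h4 - W * h3

/-- Multiply `koszul_L` by D on the right and on the left and add. The terms containing D² drop out
and twice the identity remains. -/
theorem koszul_sq (h : ContactRelations m D e i L N) :
    (L * D - D * L) * (L * D - D * L) =
      i * (L * D - D * L) + (D * i + i * D) * L := by
  have h1 := h.koszul_L
  have h2 := h.D_D
  have h3 : (2 : ℝ) • ((L * D - D * L) * (L * D - D * L)) =
      (2 : ℝ) • (i * (L * D - D * L) + (D * i + i * D) * L) := by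
    rw [ofNat_smul_eq_nsmul ℝ 2, ofNat_smul_eq_nsmul ℝ 2]
    linear_combination (norm := noncomm_ring) h1 * D + D * h1 + L * L * h2 - 2 * L * h2 * L
      + h2 * L * L
  exact smul_right_injective A (two_ne_zero (α := ℝ)) h3

/-- Since L commutes with i, the anticommutator Ki + iK equals Lℓ − ℓL, which is zero by `L_lie`. -/
theorem koszul_i (h : ContactRelations m D e i L N) :
    (L * D - D * L) * i = -(i * (L * D - D * L)) := by
  have h1 := h.L_lie
  have h2 := h.L_i
  linear_combination (norm := noncomm_ring) h1 - h2 * D - D * h2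

theorem koszul_lie (h : ContactRelations m D e i L N) :
    (L * D - D * L) * (D * i + i * D) = (D * i + i * D) * (L * D - D * L) := by
  have h1 := h.L_lie
  have h2 := h.lie_D
  generalize D * i + i * D = l at *
  linear_combination (norm := noncomm_ring) h1 * D - L * h2 - D * h1 + h2 * L

/-- Since L commutes with e, the anticommutator Ke + eK collapses to LW − WL. This is the heart of
the homotopy formula. -/
theorem koszul_e (h : ContactRelations m D e i L N) :
    (L * D - D * L) * e = algebraMap ℝ A m - N + e * i - e * (L * D - D * L) := by
  have h1 := h.L_comm
  have h2 := h.L_e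
  linear_combination (norm := noncomm_ring) h1 - D * h2 - h2 * D

end ContactRelations

end Algebra

/-! ### Pointwise relations -/

section Pointwise

/-- The relations at a point between the exterior multiplication `e` by the contact form, the
contraction `i` with the Reeb vector, the contraction `L` by the bivector, the exterior
multiplication `W` by the differential of the contact form and the degree operator `N`. -/
structure PointRelations {A : Type*} [Ring A] [Algebra ℝ A] (m : ℝ) (e i L W N : A) : Prop where
  e_e : e * e = 0
  i_i : i * i = 0
  i_e : i * e = 1 - e * i
  L_e : L * e = e * L
  L_i : L * i = i * L
  W_i : W * i = i * W
  L_W : L * W - W * L = algebraMap ℝ A m - N + e * i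

/-- Pointwise relations can be checked after evaluation at all points. -/
theorem ContactRelations.of_eval {Z X F : Type*} [AddCommGroup X] [Module ℝ X] [AddCommGroup F]
    [Module ℝ F] {ev : Z → X →ₗ[ℝ] F} (hev : ∀ α β, (∀ z, ev z α = ev z β) → α = β)
    {m : ℝ} {D e i L N : Module.End ℝ X} {e' i' L' W' N' : Z → Module.End ℝ F}
    (h : ∀ z, PointRelations m (e' z) (i' z) (L' z) (W' z) (N' z))
    (he : ∀ z α, ev z (e α) = e' z (ev z α)) (hi : ∀ z α, ev z (i α) = i' z (ev z α))
    (hL : ∀ z α, ev z (L α) = L' z (ev z α)) (hN : ∀ z α, ev z (N α) = N' z (ev z α))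
    (hW : ∀ z α, ev z ((D * e + e * D) α) = W' z (ev z α))
    (D_D : D * D = 0) (N_D : N * D = D * N + D) (N_L : N * L = L * N - 2 * L)
    (N_e : N * e = e * N + e) (N_i : N * i = i * N - i) (nilpotent : IsNilpotent L) :
    ContactRelations m D e i L N where
  D_D := D_D
  N_D := N_D
  N_L := N_L
  N_e := N_e
  N_i := N_i
  nilpotent := nilpotent
  e_e := LinearMap.ext fun α => hev _ _ fun z => by
    simpa [he] using DFunLike.congr_fun (h z).e_e (ev z α)
  i_i := LinearMap.ext fun α => hev _ _ fun z => by
    simpa [hi] using DFunLike.congr_fun (h z).i_i (ev z α)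
  i_e := LinearMap.ext fun α => hev _ _ fun z => by
    simpa [he, hi] using DFunLike.congr_fun (h z).i_e (ev z α)
  L_e := LinearMap.ext fun α => hev _ _ fun z => by
    simpa [he, hL] using DFunLike.congr_fun (h z).L_e (ev z α)
  L_i := LinearMap.ext fun α => hev _ _ fun z => by
    simpa [hi, hL] using DFunLike.congr_fun (h z).L_i (ev z α)
  comm_i := LinearMap.ext fun α => hev _ _ fun z => by
    rw [Module.End.mul_apply, Module.End.mul_apply, hW, hi, hi, hW]
    exact DFunLike.congr_fun (h z).W_i (ev z α)
  L_comm := LinearMap.ext fun α => hev _ _ fun z => by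
    rw [LinearMap.sub_apply, map_sub, Module.End.mul_apply, Module.End.mul_apply, hL, hW, hW, hL]
    simpa [he, hi, hN] using DFunLike.congr_fun (h z).L_W (ev z α)

end Pointwise

/-! ### Canonical anticommutation relations and the horizontal Lefschetz relation -/

section CAR

/-- The canonical anticommutation relations between multiplications by covectors and contractions
with vectors. -/
structure AntiCommRelations {V A : Type*} [NormedAddCommGroup V] [NormedSpace ℝ V]
    [Ring A] [Algebra ℝ A] (ε : (V →L[ℝ] ℝ) →ₗ[ℝ] A) (ι : V →ₗ[ℝ] A) : Prop where
  ε_ε : ∀ ξ ζ, ε ξ * ε ζ = -(ε ζ * ε ξ)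
  ι_ι : ∀ u v, ι u * ι v = -(ι v * ι u)
  ι_ε : ∀ v ξ, ι v * ε ξ = algebraMap ℝ A (ξ v) - ε ξ * ι v

/-- The linear algebra of a contact form at a point: `a` is the contact covector, `E` the Reeb
vector, `w` the `2`-form as a map to the dual and `g` its inverse on horizontal covectors. -/
structure HorizontalInverse {V : Type*} [NormedAddCommGroup V] [NormedSpace ℝ V]
    (a : V →L[ℝ] ℝ) (E : V) (w : V →ₗ[ℝ] (V →L[ℝ] ℝ)) (g : (V →L[ℝ] ℝ) →ₗ[ℝ] V) : Prop where
  apply_E : a E = 1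
  w_E : w E = 0
  g_a : g a = 0
  w_skew : ∀ u v, w u v = -w v u
  g_skew : ∀ ξ ζ : V →L[ℝ] ℝ, ξ (g ζ) = -ζ (g ξ)
  g_w : ∀ u, g (w u) = u - a u • E
  w_g : ∀ ξ, w (g ξ) = ξ - ξ E • a

variable {V A : Type*} [NormedAddCommGroup V] [NormedSpace ℝ V] [FiniteDimensional ℝ V]
  [Ring A] [Algebra ℝ A]

/-- The basis of the continuous dual that is dual to the chosen basis. -/
def dualVec (i : Fin (Module.finrank ℝ V)) : V →L[ℝ] ℝ :=
  ((Module.finBasis ℝ V).coord i).toContinuousLinearMap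

theorem sum_dualVec_smul (v : V) : ∑ i, dualVec i v • Module.finBasis ℝ V i = v :=
  (Module.finBasis ℝ V).sum_repr v

theorem sum_smul_dualVec (ξ : V →L[ℝ] ℝ) : ∑ i, ξ (Module.finBasis ℝ V i) • dualVec i = ξ := by
  ext v
  conv_rhs => rw [← sum_dualVec_smul v]
  simp [mul_comm]

theorem map_sum_dualVec {X : Type*} [AddCommGroup X] [Module ℝ X] (f : V →ₗ[ℝ] X) (v : V) :
    ∑ i, dualVec i v • f (Module.finBasis ℝ V i) = f v := by
  conv_rhs => rw [← sum_dualVec_smul v, map_sum]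
  simp

theorem map_sum_smul_dualVec {X : Type*} [AddCommGroup X] [Module ℝ X]
    (f : (V →L[ℝ] ℝ) →ₗ[ℝ] X) (ξ : V →L[ℝ] ℝ) :
    ∑ i, ξ (Module.finBasis ℝ V i) • f (dualVec i) = f ξ := by
  conv_rhs => rw [← sum_smul_dualVec ξ, map_sum]
  simp

variable (ε : (V →L[ℝ] ℝ) →ₗ[ℝ] A) (ι : V →ₗ[ℝ] A)

/-- The exterior multiplication by a `2`-form. -/
def twoMul (w : V →ₗ[ℝ] (V →L[ℝ] ℝ)) : A :=
  (1 / 2 : ℝ) • ∑ i, ε (dualVec i) * ε (w (Module.finBasis ℝ V i))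

/-- The contraction by the bivector `(ξ, ζ) ↦ ξ (g ζ)`. -/
def bivecContr (g : (V →L[ℝ] ℝ) →ₗ[ℝ] V) : A :=
  (1 / 2 : ℝ) • ∑ i, ι (Module.finBasis ℝ V i) * ι (g (dualVec i))

/-- The degree operator. -/
def numberOp : A := ∑ i, ε (dualVec i) * ι (Module.finBasis ℝ V i)

variable {ε ι}
  {a : V →L[ℝ] ℝ} {E : V} {w : V →ₗ[ℝ] (V →L[ℝ] ℝ)} {g : (V →L[ℝ] ℝ) →ₗ[ℝ] V}

theorem bivecContr_comm_ι (h : AntiCommRelations ε ι) (g : (V →L[ℝ] ℝ) →ₗ[ℝ] V) (v : V) :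
    bivecContr ι g * ι v = ι v * bivecContr ι g := by
  simp only [bivecContr, smul_mul_assoc, mul_smul_comm, Finset.sum_mul, Finset.mul_sum]
  congr 1
  refine Finset.sum_congr rfl fun i _ => ?_
  rw [mul_assoc, h.ι_ι _ v, mul_neg, ← mul_assoc, h.ι_ι _ v, neg_mul, neg_neg, mul_assoc]

/-- Passing ε ξ through two contractions leaves two correction terms; skewness of g makes their sums
over the basis equal, which absorbs the factor ½. -/
theorem bivecContr_mul_ε (h : AntiCommRelations ε ι)
    (hg : ∀ ξ ζ : V →L[ℝ] ℝ, ξ (g ζ) = -ζ (g ξ)) (ξ : V →L[ℝ] ℝ) :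
    bivecContr ι g * ε ξ = ε ξ * bivecContr ι g - ι (g ξ) := by
  have key : ∀ u v, ι u * ι v * ε ξ = ε ξ * (ι u * ι v) + ξ v • ι u - ξ u • ι v := by
    intro u v
    have h1 := h.ι_ε v ξ
    have h2 := h.ι_ε u ξ
    have h3 := Algebra.commutes (ξ v) (ι u)
    rw [Algebra.smul_def, Algebra.smul_def]
    linear_combination (norm := noncomm_ring) ι u * h1 - h2 * ι v - h3
  have h1 := map_sum_smul_dualVec (ι ∘ₗ g) ξ
  have h2 := map_sum_dualVec ι (g ξ)
  simp only [LinearMap.comp_apply] at h1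
  simp only [bivecContr, smul_mul_assoc, mul_smul_comm, Finset.sum_mul, Finset.mul_sum, key,
    Finset.sum_sub_distrib, Finset.sum_add_distrib, hg ξ, neg_smul, Finset.sum_neg_distrib, h1, h2]
  module

theorem twoMul_mul_ι (h : AntiCommRelations ε ι) (hw : ∀ u v, w u v = -w v u) (v : V) :
    twoMul ε w * ι v = ι v * twoMul ε w - ε (w v) := by
  have key : ∀ ξ ζ : V →L[ℝ] ℝ,
      ε ξ * ε ζ * ι v = ι v * (ε ξ * ε ζ) + ζ v • ε ξ - ξ v • ε ζ := by
    intro ξ ζ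
    have h1 := h.ι_ε v ξ
    have h2 := h.ι_ε v ζ
    have h3 := Algebra.commutes (ζ v) (ε ξ)
    rw [Algebra.smul_def, Algebra.smul_def]
    linear_combination (norm := noncomm_ring) ε ξ * h2 - h1 * ε ζ - h3
  have h1 := map_sum_smul_dualVec ε (w v)
  have h2 := map_sum_dualVec (ε ∘ₗ w) v
  simp only [LinearMap.comp_apply] at h2
  simp only [twoMul, smul_mul_assoc, mul_smul_comm, Finset.sum_mul, Finset.mul_sum, key,
    Finset.sum_sub_distrib, Finset.sum_add_distrib, hw _ v, neg_smul, Finset.sum_neg_distrib,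
    h1, h2]
  module

theorem eq_zero_of_eq_neg_self {X : Type*} [AddCommGroup X] [Module ℝ X] {x : X} (h : x = -x) :
    x = 0 := by
  have h2 : (2 : ℝ) • x = 0 := by rw [two_smul, ← sub_neg_eq_add, ← h, sub_self]
  exact (smul_eq_zero.1 h2).resolve_left two_ne_zero

/-! ### Traces and the Lefschetz commutator -/

namespace HorizontalInverse

/-- g ∘ w is the projection onto ker a along E, so the sum counts only horizontal degree: the number
operator minus its Reeb part. -/
theorem sum_ε_ι (H : HorizontalInverse a E w g) :
    ∑ i, ε (dualVec i) * ι (g (w (Module.finBasis ℝ V i))) =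
      numberOp ε ι - ε a * ι E := by
  have h1 := map_sum_smul_dualVec ε a
  simp only [H.g_w, map_sub, map_smul, mul_sub, Finset.sum_sub_distrib, mul_smul_comm, numberOp,
    ← smul_mul_assoc, ← Finset.sum_mul, h1]

/-- Expanding w(eᵢ) in the dual basis and exchanging the sums replaces w by its transpose, that is
by −w, and reduces to `sum_ε_ι`. -/
theorem sum_ε_w_ι_g (H : HorizontalInverse a E w g) :
    ∑ i, ε (w (Module.finBasis ℝ V i)) * ι (g (dualVec i)) =
      -(numberOp ε ι - ε a * ι E) := by
  rw [← H.sum_ε_ι, ← Finset.sum_neg_distrib]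
  have h1 : ∀ i : Fin (Module.finrank ℝ V),
      ε (w (Module.finBasis ℝ V i)) * ι (g (dualVec i)) =
      ∑ j, w (Module.finBasis ℝ V i) (Module.finBasis ℝ V j) •
        (ε (dualVec j) * ι (g (dualVec i))) := fun i => by
    rw [← map_sum_smul_dualVec ε (w (Module.finBasis ℝ V i)), Finset.sum_mul]
    simp only [smul_mul_assoc]
  simp only [h1]
  rw [Finset.sum_comm]
  refine Finset.sum_congr rfl fun j _ => ?_
  have h2 := map_sum_smul_dualVec (ι ∘ₗ g) (w (Module.finBasis ℝ V j))
  simp only [LinearMap.comp_apply] at h2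
  rw [← h2, Finset.mul_sum, ← Finset.sum_neg_distrib]
  refine Finset.sum_congr rfl fun i _ => ?_
  rw [H.w_skew, neg_smul, mul_smul_comm]

/-- By skewness this is minus the trace of w ∘ g, a projection of rank dim V − 1. -/
theorem sum_apply (H : HorizontalInverse a E w g) :
    ∑ i, w (Module.finBasis ℝ V i) (g (dualVec i)) = 1 - (Module.finrank ℝ V : ℝ) := by
  have h1 : ∀ i : Fin (Module.finrank ℝ V), w (Module.finBasis ℝ V i) (g (dualVec i)) =
      dualVec i E • a (Module.finBasis ℝ V i) - 1 := by
    intro i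
    rw [H.w_skew, H.w_g]
    have : dualVec i (Module.finBasis ℝ V i) = 1 := by simp [dualVec]
    simp [this]
  have h2 := map_sum_dualVec (a : V →ₗ[ℝ] ℝ) E
  simp only [ContinuousLinearMap.coe_coe, H.apply_E] at h2
  simp only [h1, Finset.sum_sub_distrib, h2]
  simp

/-- The horizontal Lefschetz relation. -/
theorem bivecContr_twoMul (h : AntiCommRelations ε ι) (H : HorizontalInverse a E w g) :
    bivecContr ι g * twoMul ε w - twoMul ε w * bivecContr ι g =
      algebraMap ℝ A (((Module.finrank ℝ V : ℝ) - 1) / 2) - numberOp ε ι + ε a * ι E := by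
  have key : ∀ ξ ζ : V →L[ℝ] ℝ, bivecContr ι g * (ε ξ * ε ζ) =
      ε ξ * ε ζ * bivecContr ι g + ε ζ * ι (g ξ) - ε ξ * ι (g ζ) - algebraMap ℝ A (ζ (g ξ)) := by
    intro ξ ζ
    have h1 := bivecContr_mul_ε h H.g_skew ξ
    have h2 := bivecContr_mul_ε h H.g_skew ζ
    have h3 := h.ι_ε (g ξ) ζ
    linear_combination (norm := noncomm_ring) h1 * ε ζ + ε ξ * h2 - h3
  have h1 : bivecContr ι g * twoMul ε w - twoMul ε w * bivecContr ι g =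
      (1 / 2 : ℝ) • (-(numberOp ε ι - ε a * ι E) - (numberOp ε ι - ε a * ι E) -
        algebraMap ℝ A (1 - (Module.finrank ℝ V : ℝ))) := by
    rw [← H.sum_apply, map_sum]
    conv_rhs => enter [2, 1]; rw [← H.sum_ε_w_ι_g, ← H.sum_ε_ι]
    rw [twoMul, mul_smul_comm, smul_mul_assoc, ← smul_sub]
    simp only [Finset.mul_sum, Finset.sum_mul, ← Finset.sum_sub_distrib, key]
    congr 1
    refine Finset.sum_congr rfl fun i _ => ?_
    abel
  rw [h1]
  simp only [Algebra.algebraMap_eq_smul_one]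
  module

theorem pointRelations (h : AntiCommRelations ε ι) (H : HorizontalInverse a E w g) :
    PointRelations (((Module.finrank ℝ V : ℝ) - 1) / 2) (ε a) (ι E) (bivecContr ι g)
      (twoMul ε w) (numberOp ε ι) where
  e_e := eq_zero_of_eq_neg_self (h.ε_ε a a)
  i_i := eq_zero_of_eq_neg_self (h.ι_ι E E)
  i_e := by rw [h.ι_ε, H.apply_E, map_one]
  L_e := by rw [bivecContr_mul_ε h H.g_skew, H.g_a, map_zero, sub_zero]
  L_i := bivecContr_comm_ι h g E
  W_i := by rw [twoMul_mul_ι h H.w_skew, H.w_E, map_zero, sub_zero]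
  L_W := bivecContr_twoMul h H

end HorizontalInverse

end CAR

/-! ### Operators on graded spaces -/

section Graded

variable {X : ℕ → Type*} [∀ k, AddCommGroup (X k)] [∀ k, Module ℝ (X k)]

/-- The operator of degree `1` with the given components. -/
def raise (f : ∀ k, X k →ₗ[ℝ] X (k + 1)) : Module.End ℝ (∀ k, X k) where
  toFun α
    | 0 => 0
    | k + 1 => f k (α k)
  map_add' α β := by
    funext k
    cases k with
    | zero => exact (add_zero 0).symm
    | succ k => exact map_add (f k) _ _
  map_smul' c α := by
    funext k
    cases k with
    | zero => exact (smul_zero c).symm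
    | succ k => exact map_smul (f k) _ _

/-- The operator of degree `-1` with the given components. -/
def lower (f : ∀ k, X (k + 1) →ₗ[ℝ] X k) : Module.End ℝ (∀ k, X k) :=
  LinearMap.pi fun k => f k ∘ₗ LinearMap.proj (k + 1)

/-- The operator of degree `-2` with the given components. -/
def lowerTwo (f : ∀ k, X (k + 2) →ₗ[ℝ] X k) : Module.End ℝ (∀ k, X k) :=
  LinearMap.pi fun k => f k ∘ₗ LinearMap.proj (k + 2)

variable (X) in
/-- The multiplication by the degree. -/
def degree : Module.End ℝ (∀ k, X k) :=
  LinearMap.pi fun k => (k : ℝ) • LinearMap.proj k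

@[simp] theorem raise_apply_zero (f : ∀ k, X k →ₗ[ℝ] X (k + 1)) (α : ∀ k, X k) :
    raise f α 0 = 0 := rfl

@[simp] theorem raise_apply_succ (f : ∀ k, X k →ₗ[ℝ] X (k + 1)) (α : ∀ k, X k) (k : ℕ) :
    raise f α (k + 1) = f k (α k) := rfl

@[simp] theorem lower_apply (f : ∀ k, X (k + 1) →ₗ[ℝ] X k) (α : ∀ k, X k) (k : ℕ) :
    lower f α k = f k (α (k + 1)) := rfl

@[simp] theorem lowerTwo_apply (f : ∀ k, X (k + 2) →ₗ[ℝ] X k) (α : ∀ k, X k) (k : ℕ) :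
    lowerTwo f α k = f k (α (k + 2)) := rfl

@[simp] theorem degree_apply (α : ∀ k, X k) (k : ℕ) : degree X α k = (k : ℝ) • α k := rfl

theorem degree_mul_raise (f : ∀ k, X k →ₗ[ℝ] X (k + 1)) :
    degree X * raise f = raise f * degree X + raise f := by
  refine LinearMap.ext fun α => funext fun k => ?_
  cases k with
  | zero => simp
  | succ k => simp [add_smul]

theorem degree_mul_lower (f : ∀ k, X (k + 1) →ₗ[ℝ] X k) :
    degree X * lower f = lower f * degree X - lower f := by
  refine LinearMap.ext fun α => funext fun k => ?_
  simp [add_smul]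

theorem degree_mul_lowerTwo (f : ∀ k, X (k + 2) →ₗ[ℝ] X k) :
    degree X * lowerTwo f = lowerTwo f * degree X - 2 * lowerTwo f := by
  refine LinearMap.ext fun α => funext fun k => ?_
  rw [two_mul]
  simp only [Module.End.mul_apply, degree_apply, LinearMap.sub_apply, LinearMap.add_apply,
    Pi.sub_apply, Pi.add_apply, lowerTwo_apply, map_smul]
  push_cast
  module

/-- After p applications the entry in degree k comes from degree k + 2p, where the space is trivial
once k + 2p ≥ n. -/
theorem isNilpotent_lowerTwo (f : ∀ k, X (k + 2) →ₗ[ℝ] X k) (n : ℕ)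
    (hX : ∀ k, n ≤ k → Subsingleton (X k)) : IsNilpotent (lowerTwo f) := by
  refine ⟨n, LinearMap.ext fun α => ?_⟩
  have key : ∀ p k, n ≤ k + 2 * p → (lowerTwo f ^ p) α k = 0 := by
    intro p
    induction p with
    | zero => exact fun k hk => (hX k (by omega)).elim _ _
    | succ p ih =>
      intro k hk
      rw [pow_succ', Module.End.mul_apply, lowerTwo_apply, ih (k + 2) (by omega), map_zero]
  exact funext fun k => key n k (by omega)

end Graded

/-! ### Exterior algebra at a point -/

section Fibre

variable {V : Type*} [NormedAddCommGroup V] [NormedSpace ℝ V] {k : ℕ}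

open ContinuousAlternatingMap hiding map_zero map_sum

/-- The alternation `∑ B(eᵢ, eⱼ) eⁱ ∧ eʲ ∧ b`. -/
def bilinWedge (B : V →L[ℝ] V →L[ℝ] ℝ) (b : V [⋀^Fin k]→L[ℝ] ℝ) : V [⋀^Fin (k + 2)]→L[ℝ] ℝ :=
  alternatizeUncurryFin (alternatizeUncurryFinCLM ℝ V ℝ ∘L
    ((ContinuousLinearMap.smulRightL ℝ V (V [⋀^Fin k]→L[ℝ] ℝ)).flip b) ∘L B)

/-- Only the skew part of B survives alternation. This yields the anticommutation of covectors, the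
replacement of the derivative of η by dη, and an analogous cancellation in the Leibniz rule. -/
theorem bilinWedge_of_symmetric {B : V →L[ℝ] V →L[ℝ] ℝ} (hB : ∀ u v, B u v = B v u)
    (b : V [⋀^Fin k]→L[ℝ] ℝ) : bilinWedge B b = 0 := by
  refine alternatizeUncurryFin_alternatizeUncurryFinCLM_comp_of_symmetric fun u v => ?_
  simp [hB u v]

theorem bilinWedge_add (B C : V →L[ℝ] V →L[ℝ] ℝ) (b : V [⋀^Fin k]→L[ℝ] ℝ) :
    bilinWedge (B + C) b = bilinWedge B b + bilinWedge C b := by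
  rw [bilinWedge, ContinuousLinearMap.comp_add, ContinuousLinearMap.comp_add,
    alternatizeUncurryFin_add]
  rfl

theorem bilinWedge_smul (r : ℝ) (B : V →L[ℝ] V →L[ℝ] ℝ) (b : V [⋀^Fin k]→L[ℝ] ℝ) :
    bilinWedge (r • B) b = r • bilinWedge B b := by
  rw [bilinWedge, ContinuousLinearMap.comp_smul, ContinuousLinearMap.comp_smul,
    alternatizeUncurryFin_smul]
  rfl

theorem bilinWedge_sum {ι : Type*} (s : Finset ι) (f : ι → V →L[ℝ] V →L[ℝ] ℝ)
    (b : V [⋀^Fin k]→L[ℝ] ℝ) : bilinWedge (∑ i ∈ s, f i) b = ∑ i ∈ s, bilinWedge (f i) b := by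
  classical
  induction s using Finset.induction_on with
  | empty => exact bilinWedge_of_symmetric (fun _ _ => rfl) b
  | insert i s hi ih => rw [Finset.sum_insert hi, Finset.sum_insert hi, bilinWedge_add, ih]

theorem alternatizeUncurryFin_comp {W : Type*} [NormedAddCommGroup W] [NormedSpace ℝ W]
    (f : V →L[ℝ] V [⋀^Fin k]→L[ℝ] ℝ) (A : W →L[ℝ] V) :
    (alternatizeUncurryFin f).compContinuousLinearMap A =
      alternatizeUncurryFin (compContinuousLinearMapCLM A ∘L f ∘L A) := by
  ext v
  simp only [compContinuousLinearMap_apply, alternatizeUncurryFin_apply]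
  rfl

theorem bilinWedge_comp (B : V →L[ℝ] V →L[ℝ] ℝ) (b : V [⋀^Fin k]→L[ℝ] ℝ) (A : V →L[ℝ] V) :
    (bilinWedge B b).compContinuousLinearMap A =
      bilinWedge (A.precomp ℝ ∘L B ∘L A) (b.compContinuousLinearMap A) := by
  rw [bilinWedge, bilinWedge, alternatizeUncurryFin_comp]
  congr 1
  refine ContinuousLinearMap.ext fun v => ?_
  exact alternatizeUncurryFin_comp ((B (A v)).smulRight b) A

/-- A `2`-form as a map to the dual space. -/
def twoFlat (w : V [⋀^Fin 2]→L[ℝ] ℝ) : V →L[ℝ] V →L[ℝ] ℝ :=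
  ((ofSubsingletonLIE (𝕜 := ℝ) (E := V) (F := ℝ) (0 : Fin 1)).symm.toContinuousLinearEquiv :
      (V [⋀^Fin 1]→L[ℝ] ℝ) →L[ℝ] (V →L[ℝ] ℝ)) ∘L w.curryLeft

@[simp] theorem twoFlat_apply (w : V [⋀^Fin 2]→L[ℝ] ℝ) (u v : V) : twoFlat w u v = w ![u, v] := by
  have : twoFlat w u = covec (w.curryLeft u) := rfl
  rw [this]; simp

theorem twoFlat_skew (w : V [⋀^Fin 2]→L[ℝ] ℝ) (u v : V) : twoFlat w u v = -twoFlat w v u := by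
  have h := w.toAlternatingMap.map_swap ![v, u] (i := 0) (j := 1) (by simp)
  change w _ = -w _ at h
  rw [twoFlat_apply, twoFlat_apply, ← h]
  congr 1
  ext i; fin_cases i <;> rfl

theorem twoFlat_comp (w : V [⋀^Fin 2]→L[ℝ] ℝ) (A : V →L[ℝ] V) :
    twoFlat (w.compContinuousLinearMap A) = A.precomp ℝ ∘L twoFlat w ∘L A := by
  ext v u
  simp only [twoFlat_apply, ContinuousLinearMap.comp_apply, ContinuousLinearMap.precomp_apply,
    compContinuousLinearMap_apply]
  congr 1
  ext i; fin_cases i <;> rfl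

/-- The exterior multiplication by a covector on `k`-forms. -/
def covecMul (ξ : V →L[ℝ] ℝ) (k : ℕ) :
    (V [⋀^Fin k]→L[ℝ] ℝ) →ₗ[ℝ] (V [⋀^Fin (k + 1)]→L[ℝ] ℝ) where
  toFun b := alternatizeUncurryFin (ξ.smulRight b)
  map_add' b c := by
    rw [← alternatizeUncurryFin_add]
    congr 1; ext; simp
  map_smul' r b := by
    rw [RingHom.id_apply, ← alternatizeUncurryFin_smul]
    congr 1; ext; simp [mul_left_comm]

theorem covecMul_covecMul (ξ ζ : V →L[ℝ] ℝ) (b : V [⋀^Fin k]→L[ℝ] ℝ) :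
    covecMul ξ (k + 1) (covecMul ζ k b) = bilinWedge (ξ.smulRight ζ) b := by
  change alternatizeUncurryFin (ξ.smulRight (alternatizeUncurryFin (ζ.smulRight b))) =
    alternatizeUncurryFin _
  congr 1
  refine ContinuousLinearMap.ext fun v => ?_
  change ξ v • alternatizeUncurryFin (ζ.smulRight b) =
    alternatizeUncurryFin ((ξ v • ζ).smulRight b)
  rw [← alternatizeUncurryFin_smul]
  congr 1
  ext; simp [mul_assoc]

variable (V) in
/-- The alternating forms of all degrees. -/
abbrev ExtForms : Type _ := ∀ k, V [⋀^Fin k]→L[ℝ] ℝ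

/-- The exterior multiplication by a covector on forms of all degrees. -/
def covecMulTot : (V →L[ℝ] ℝ) →ₗ[ℝ] Module.End ℝ (ExtForms V) where
  toFun ξ := raise (covecMul ξ)
  map_add' ξ ζ := by
    refine LinearMap.ext fun α => funext fun k => ?_
    cases k with
    | zero => exact (add_zero 0).symm
    | succ k =>
      change alternatizeUncurryFin ((ξ + ζ).smulRight (α k)) =
        alternatizeUncurryFin (ξ.smulRight (α k)) + alternatizeUncurryFin (ζ.smulRight (α k))
      rw [← alternatizeUncurryFin_add]
      congr 1; ext; simp [add_mul]
  map_smul' r ξ := by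
    refine LinearMap.ext fun α => funext fun k => ?_
    cases k with
    | zero => exact (smul_zero r).symm
    | succ k =>
      change alternatizeUncurryFin ((r • ξ).smulRight (α k)) =
        r • alternatizeUncurryFin (ξ.smulRight (α k))
      rw [← alternatizeUncurryFin_smul]
      congr 1; ext; simp [mul_assoc]

/-- The contraction of `(k + 1)`-forms with a vector. -/
def vecContr (v : V) (k : ℕ) :
    (V [⋀^Fin (k + 1)]→L[ℝ] ℝ) →ₗ[ℝ] (V [⋀^Fin k]→L[ℝ] ℝ) where
  toFun a := a.curryLeft v
  map_add' _ _ := rfl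
  map_smul' _ _ := rfl

/-- The contraction with a vector on forms of all degrees. -/
def vecContrTot : V →ₗ[ℝ] Module.End ℝ (ExtForms V) where
  toFun v := lower (vecContr v)
  map_add' u v := by
    refine LinearMap.ext fun α => funext fun k => ?_
    exact map_add (α (k + 1)).curryLeft u v
  map_smul' r v := by
    refine LinearMap.ext fun α => funext fun k => ?_
    exact map_smul (α (k + 1)).curryLeft r v

theorem vecContr_covecMul_zero (v : V) (ξ : V →L[ℝ] ℝ) (b : V [⋀^Fin 0]→L[ℝ] ℝ) :
    vecContr v 0 (covecMul ξ 0 b) = ξ v • b := by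
  ext u
  change alternatizeUncurryFin (ξ.smulRight b) (Matrix.vecCons v u) = _
  rw [alternatizeUncurryFin_apply]
  simp [Subsingleton.elim _ u]

/-- In the alternating sum for ξ ∧ b evaluated with v in front, the first term is ξ(v) b. Every
other term keeps v as first argument of b, and the index shift by one supplies the minus sign. -/
theorem vecContr_covecMul_succ (v : V) (ξ : V →L[ℝ] ℝ) (b : V [⋀^Fin (k + 1)]→L[ℝ] ℝ) :
    vecContr v (k + 1) (covecMul ξ (k + 1) b) = ξ v • b - covecMul ξ k (vecContr v k b) := by
  ext u
  change alternatizeUncurryFin (ξ.smulRight b) (Matrix.vecCons v u) =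
    ξ v * b u - alternatizeUncurryFin (ξ.smulRight (b.curryLeft v)) u
  rw [alternatizeUncurryFin_apply, alternatizeUncurryFin_apply, Fin.sum_univ_succ, sub_eq_add_neg,
    ← Finset.sum_neg_distrib]
  congr 1
  · simp [Matrix.vecCons]
  · refine Finset.sum_congr rfl fun i _ => ?_
    have : i.succ.removeNth (Matrix.vecCons v u) = Matrix.vecCons v (i.removeNth u) := by
      ext j
      refine Fin.cases ?_ (fun j => ?_) j <;> simp [Fin.removeNth]
    simp [this, pow_succ]

theorem antiCommRelations :
    AntiCommRelations (A := Module.End ℝ (ExtForms V)) covecMulTot vecContrTot where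
  ε_ε ξ ζ := by
    refine LinearMap.ext fun α => funext fun k => ?_
    match k with
    | 0 => exact neg_zero.symm
    | 1 =>
      change covecMul ξ 0 0 = -covecMul ζ 0 0
      simp
    | k + 2 =>
      change covecMul ξ (k + 1) (covecMul ζ k (α k)) = -covecMul ζ (k + 1) (covecMul ξ k (α k))
      rw [covecMul_covecMul, covecMul_covecMul, eq_neg_iff_add_eq_zero, ← bilinWedge_add]
      refine bilinWedge_of_symmetric (fun u v => ?_) _
      simp; ring
  ι_ι u v := by
    refine LinearMap.ext fun α => funext fun k => ?_
    -- Polarization of the identity i_v i_v = 0.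
    have h := curryLeft_same (α (k + 2)) (u + v)
    simp only [map_add, curryLeft_add, _root_.add_apply, curryLeft_same, zero_add, add_zero] at h
    exact eq_neg_of_add_eq_zero_left h
  ι_ε v ξ := by
    refine LinearMap.ext fun α => funext fun k => ?_
    cases k with
    | zero =>
      change vecContr v 0 (covecMul ξ 0 (α 0)) = ξ v • α 0 - 0
      rw [vecContr_covecMul_zero, sub_zero]
    | succ k => exact vecContr_covecMul_succ v ξ (α (k + 1))

/-- The Reeb vector of a pair of a covector and a `2`-form. -/
def reebVec (a : V [⋀^Fin 1]→L[ℝ] ℝ) (w : V [⋀^Fin 2]→L[ℝ] ℝ) : V :=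
  (flat a w).inverse (covec a)

/-- The horizontal part of the inverse of `♭`. -/
def horizontalSharp (a : V [⋀^Fin 1]→L[ℝ] ℝ) (w : V [⋀^Fin 2]→L[ℝ] ℝ) : (V →L[ℝ] ℝ) →ₗ[ℝ] V :=
  ((flat a w).inverse : (V →L[ℝ] ℝ) →ₗ[ℝ] V) -
    (LinearMap.applyₗ (reebVec a w) ∘ₗ ContinuousLinearMap.coeLM ℝ).smulRight (reebVec a w)

theorem horizontalSharp_apply (a : V [⋀^Fin 1]→L[ℝ] ℝ) (w : V [⋀^Fin 2]→L[ℝ] ℝ) (ξ : V →L[ℝ] ℝ) :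
    horizontalSharp a w ξ = (flat a w).inverse ξ - ξ (reebVec a w) • reebVec a w := rfl

variable [FiniteDimensional ℝ V]

/-- Dual bases write the curried form as ∑ eⁱ ⊗ i_{eᵢ} α, and alternating the curried form of a (k +
1)-form multiplies that form by k + 1. -/
theorem numberOp_eq : numberOp (A := Module.End ℝ (ExtForms V)) covecMulTot vecContrTot = degree _ := by
  refine LinearMap.ext fun α => funext fun k => ?_
  rw [numberOp, LinearMap.sum_apply, Finset.sum_apply]
  cases k with
  | zero =>
    rw [degree_apply, Nat.cast_zero, zero_smul]
    exact Finset.sum_eq_zero fun i _ => rfl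
  | succ k =>
    have h : (α (k + 1)).curryLeft = ∑ i, (dualVec i).smulRight
        ((α (k + 1)).curryLeft (Module.finBasis ℝ V i)) := by
      ext1 v
      rw [_root_.sum_apply]
      exact (map_sum_dualVec (α (k + 1)).curryLeft.toLinearMap v).symm
    have h2 := congrArg (alternatizeUncurryFinCLM ℝ V ℝ) h
    rw [map_sum, alternatizeUncurryFinCLM_apply, alternatizeUncurryFin_curryLeft] at h2
    rw [degree_apply, Nat.cast_smul_eq_nsmul, h2]
    rfl

theorem twoMul_covecMulTot_apply (B : V →L[ℝ] V →L[ℝ] ℝ) (α : ExtForms V) (k : ℕ) :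
    twoMul (A := Module.End ℝ (ExtForms V)) covecMulTot (B : V →ₗ[ℝ] (V →L[ℝ] ℝ)) α (k + 2) =
      (1 / 2 : ℝ) • bilinWedge B (α k) := by
  have hB : B = ∑ i, (dualVec i).smulRight (B (Module.finBasis ℝ V i)) := by
    ext1 v
    rw [_root_.sum_apply]
    exact (map_sum_dualVec B.toLinearMap v).symm
  rw [twoMul, LinearMap.smul_apply, Pi.smul_apply, LinearMap.sum_apply, Finset.sum_apply]
  conv_rhs => rw [hB, bilinWedge_sum]
  congr 1
  exact Finset.sum_congr rfl fun i _ => covecMul_covecMul _ _ _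

/-- The contraction of `(k + 2)`-forms with a bivector. -/
def contractL (P : (V →L[ℝ] ℝ) [⋀^Fin 2]→L[ℝ] ℝ) (k : ℕ) :
    (V [⋀^Fin (k + 2)]→L[ℝ] ℝ) →ₗ[ℝ] (V [⋀^Fin k]→L[ℝ] ℝ) where
  toFun := contract P
  map_add' := contract_add P
  map_smul' r := contract_smul r P

/-- For fixed j, summing over the first index gives ∑ᵢ eⁱ(g eʲ) eᵢ = g eʲ, so the double sum in
`contract` becomes the single sum in `bivecContr`. -/
theorem lowerTwo_contractL {P : (V →L[ℝ] ℝ) [⋀^Fin 2]→L[ℝ] ℝ} {g : (V →L[ℝ] ℝ) →ₗ[ℝ] V}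
    (hP : ∀ ξ ζ, P ![ξ, ζ] = ξ (g ζ)) : 
    lowerTwo (contractL P) = bivecContr (A := Module.End ℝ (ExtForms V)) vecContrTot g := by
  refine LinearMap.ext fun α => funext fun k => ?_
  change contract P (α (k + 2)) = _
  rw [contract, bivecContr, LinearMap.smul_apply, Pi.smul_apply, LinearMap.sum_apply,
    Finset.sum_apply, Finset.sum_comm]
  congr 1
  refine Finset.sum_congr rfl fun j _ => ?_
  have h := map_sum_dualVec (α (k + 2)).curryLeft.toLinearMap (g (dualVec j))
  change _ = ((α (k + 2)).curryLeft (g (dualVec j))).curryLeft (Module.finBasis ℝ V j)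
  have h2 := congrArg (vecContr (Module.finBasis ℝ V j) k) h
  rw [map_sum] at h2
  refine Eq.trans (Finset.sum_congr rfl fun i _ => ?_) h2
  rw [map_smul]
  exact congrArg (· • _) (hP _ _)

/-- A skew-symmetric bilinear form in odd dimension is degenerate. -/
theorem exists_ne_zero_twoFlat_eq_zero (hV : Odd (Module.finrank ℝ V)) (w : V [⋀^Fin 2]→L[ℝ] ℝ) :
    ∃ v, v ≠ 0 ∧ twoFlat w v = 0 := by
  let b := Module.finBasis ℝ V
  let Q : Matrix (Fin (Module.finrank ℝ V)) (Fin (Module.finrank ℝ V)) ℝ :=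
    Matrix.of fun i j => twoFlat w (b i) (b j)
  have hQ : Q.transpose = -Q := by
    ext i j
    exact twoFlat_skew w (b j) (b i)
  have hdet : Q.det = 0 := by
    have h := Q.det_transpose
    rw [hQ, Matrix.det_neg, Fintype.card_fin, hV.neg_one_pow] at h
    linarith
  obtain ⟨c, hc, hc0⟩ := Matrix.exists_vecMul_eq_zero_iff.2 hdet
  refine ⟨∑ i, c i • b i, fun h => hc ?_, ?_⟩
  · exact funext (Fintype.linearIndependent_iff.1 b.linearIndependent c h)
  · have : (twoFlat w (∑ i, c i • b i) : V →ₗ[ℝ] ℝ) = 0 := by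
      refine b.ext fun j => ?_
      have h := congrFun hc0 j
      simpa [Matrix.vecMul, dotProduct, Q] using h
    ext v
    exact DFunLike.congr_fun this v

/-- In odd dimension w kills some v ≠ 0, so ♭ v = a(v) a, and a(v) ≠ 0 by injectivity of ♭. Hence
the Reeb vector is v / a(v), which gives w(E) = 0 and a(E) = 1. The rest comes from splitting off
the E-component of ♭⁻¹. -/
theorem horizontalInverse (hV : Odd (Module.finrank ℝ V)) {a : V [⋀^Fin 1]→L[ℝ] ℝ}
    {w : V [⋀^Fin 2]→L[ℝ] ℝ} (h : (flat a w).IsInvertible) :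
    HorizontalInverse (covec a) (reebVec a w) (twoFlat w : V →ₗ[ℝ] (V →L[ℝ] ℝ))
      (horizontalSharp a w) := by
  have hflat : ∀ v, flat a w v = twoFlat w v + covec a v • covec a := fun v => rfl
  obtain ⟨v, hv, hv0⟩ := exists_ne_zero_twoFlat_eq_zero hV w
  have hav : covec a v ≠ 0 := by
    intro h0
    have h1 := hflat v
    rw [hv0, h0, zero_smul, add_zero] at h1
    apply hv
    rw [← h.inverse_apply_self v, h1, map_zero]
  have hE : reebVec a w = (covec a v)⁻¹ • v := by
    have h1 := hflat v
    rw [hv0, zero_add] at h1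
    have h2 := h.inverse_apply_self v
    rw [h1, map_smul] at h2
    rw [reebVec, eq_inv_smul_iff₀ hav, h2]
  have hwE : twoFlat w (reebVec a w) = 0 := by rw [hE, map_smul, hv0, smul_zero]
  have haE : covec a (reebVec a w) = 1 := by
    rw [hE, map_smul, smul_eq_mul, inv_mul_cancel₀ hav]
  have hwE' : ∀ u, twoFlat w u (reebVec a w) = 0 := fun u => by
    rw [twoFlat_skew, hwE]; simp
  have hs : ∀ ξ, twoFlat w ((flat a w).inverse ξ) + covec a ((flat a w).inverse ξ) • covec a = ξ :=
    fun ξ => (hflat _).symm.trans (h.self_apply_inverse ξ)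
  -- Evaluating ♭(♭⁻¹ ξ) = ξ at E removes the w-term.
  have has : ∀ ξ, covec a ((flat a w).inverse ξ) = ξ (reebVec a w) := fun ξ => by
    conv_rhs => rw [← hs ξ]
    rw [_root_.add_apply, hwE', _root_.smul_apply, haE]
    simp
  have hwg : ∀ ξ, twoFlat w (horizontalSharp a w ξ) = ξ - ξ (reebVec a w) • covec a := fun ξ => by
    rw [horizontalSharp_apply, map_sub, map_smul, hwE, smul_zero, sub_zero, ← has]
    exact eq_sub_of_add_eq (hs ξ)
  have hag : ∀ ξ, covec a (horizontalSharp a w ξ) = 0 := fun ξ => by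
    rw [horizontalSharp_apply, map_sub, map_smul, haE, has]
    simp
  refine ⟨haE, hwE, ?_, twoFlat_skew w, fun ξ ζ => ?_, fun u => ?_, hwg⟩
  · rw [horizontalSharp_apply, haE, one_smul]
    exact sub_self _
  -- Skewness of g is inherited from w: the correction ξ(E) a in w(g ξ) vanishes on the horizontal
  -- vector g ζ.
  · have h1 : ∀ ξ ζ, ξ (horizontalSharp a w ζ) =
        twoFlat w (horizontalSharp a w ξ) (horizontalSharp a w ζ) := fun ξ ζ => by
      rw [hwg, _root_.sub_apply, _root_.smul_apply, hag, smul_zero, sub_zero]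
    rw [h1 ξ ζ, h1 ζ ξ, twoFlat_skew]
  · have h1 : twoFlat w u = flat a w u - covec a u • covec a := eq_sub_of_add_eq (hflat u).symm
    change horizontalSharp a w (twoFlat w u) = _
    rw [horizontalSharp_apply, hwE', zero_smul, sub_zero, h1, map_sub, map_smul,
      h.inverse_apply_self]
    rfl

/-- ♭⁻¹ and g differ by a multiple of E, which w annihilates. This brings Λ to the shape ξ(g ζ)
needed by `lowerTwo_contractL`. -/
theorem compContinuousLinearMap_inverse_apply (hV : Odd (Module.finrank ℝ V))
    {a : V [⋀^Fin 1]→L[ℝ] ℝ} {w : V [⋀^Fin 2]→L[ℝ] ℝ} (h : (flat a w).IsInvertible)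
    (ξ ζ : V →L[ℝ] ℝ) :
    w.compContinuousLinearMap (flat a w).inverse ![ξ, ζ] = ξ (horizontalSharp a w ζ) := by
  have H := horizontalInverse hV h
  have h1 : ∀ ξ, (flat a w).inverse ξ = horizontalSharp a w ξ + ξ (reebVec a w) • reebVec a w :=
    fun ξ => (sub_add_cancel _ _).symm
  have h2 : w.compContinuousLinearMap (flat a w).inverse ![ξ, ζ] =
      twoFlat w ((flat a w).inverse ξ) ((flat a w).inverse ζ) := by
    rw [twoFlat_apply, compContinuousLinearMap_apply]
    congr 1
    ext i; fin_cases i <;> rfl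
  have h3 : twoFlat w (reebVec a w) = 0 := H.w_E
  have h4 : ∀ ξ, covec a (horizontalSharp a w ξ) = 0 := fun ξ => by
    rw [H.g_skew, H.g_a, map_zero, neg_zero]
  have h5 : twoFlat w (horizontalSharp a w ξ) = ξ - ξ (reebVec a w) • covec a := H.w_g ξ
  rw [h2, h1 ξ, map_add, map_smul, h3, smul_zero, add_zero, h5, _root_.sub_apply,
    _root_.smul_apply, h1 ζ, map_add, map_add, map_smul, map_smul, h4, H.apply_E]
  simp only [smul_eq_mul]
  ring

theorem subsingleton_of_finrank_lt (hk : Module.finrank ℝ V < k) :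
    Subsingleton (V [⋀^Fin k]→L[ℝ] ℝ) := by
  refine ⟨fun b c => toAlternatingMap_injective ?_⟩
  refine Module.Basis.ext_alternating (Module.finBasis ℝ V) fun i hi => ?_
  have := Fintype.card_le_of_injective i hi
  simp only [Fintype.card_fin] at this
  omega

end Fibre

/-! ### The exterior derivative of `η ∧ a` in a vector space -/

section Chart

variable {V : Type*} [NormedAddCommGroup V] [NormedSpace ℝ V] {k : ℕ}

open ContinuousAlternatingMap hiding map_zero map_sum

variable (V) in
/-- `covec` as a continuous linear map. -/
def covecL : (V [⋀^Fin 1]→L[ℝ] ℝ) →L[ℝ] (V →L[ℝ] ℝ) :=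
  ((ofSubsingletonLIE (𝕜 := ℝ) (E := V) (F := ℝ) (0 : Fin 1)).symm.toContinuousLinearEquiv :
      (V [⋀^Fin 1]→L[ℝ] ℝ) →L[ℝ] (V →L[ℝ] ℝ))

theorem covecL_apply (a : V [⋀^Fin 1]→L[ℝ] ℝ) : covecL V a = covec a := rfl

theorem twoFlat_alternatizeUncurryFin (B : V →L[ℝ] V [⋀^Fin 1]→L[ℝ] ℝ) (u v : V) :
    twoFlat (alternatizeUncurryFin B) u v = covec (B u) v - covec (B v) u := by
  rw [twoFlat_apply, alternatizeUncurryFin_apply, Fin.sum_univ_two, covec_apply, covec_apply]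
  have h0 : (0 : Fin 2).removeNth ![u, v] = ![v] := by
    ext i; fin_cases i; rfl
  have h1 : (1 : Fin 2).removeNth ![u, v] = ![u] := by
    ext i; fin_cases i; rfl
  rw [h0, h1]
  simp [sub_eq_add_neg]

/-- Twice a bilinear form is its skew part B(u, v) − B(v, u) plus a symmetric form, and the
symmetric form wedges to zero. -/
theorem bilinWedge_covecL_comp (B : V →L[ℝ] V [⋀^Fin 1]→L[ℝ] ℝ) (b : V [⋀^Fin k]→L[ℝ] ℝ) :
    bilinWedge (covecL V ∘L B) b =
      (1 / 2 : ℝ) • bilinWedge (twoFlat (alternatizeUncurryFin B)) b := by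
  have h1 : (2 : ℝ) • (covecL V ∘L B) = twoFlat (alternatizeUncurryFin B) +
      ((covecL V ∘L B) + (covecL V ∘L B).flip) := by
    ext u v
    have h := twoFlat_alternatizeUncurryFin B u v
    simp only [_root_.add_apply, _root_.smul_apply, h, ContinuousLinearMap.flip_apply,
      ContinuousLinearMap.comp_apply, covecL_apply, smul_eq_mul]
    ring
  have h2 := congrArg (fun C => bilinWedge C b) h1
  simp only [bilinWedge_smul, bilinWedge_add _ (covecL V ∘L B + _)] at h2
  rw [bilinWedge_of_symmetric (B := covecL V ∘L B + (covecL V ∘L B).flip)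
    (fun u v => by simp [add_comm]), add_zero] at h2
  rw [← h2, smul_smul]
  norm_num

theorem hasFDerivAt_clm_smulRight {F G : Type*} [NormedAddCommGroup F] [NormedSpace ℝ F]
    [NormedAddCommGroup G] [NormedSpace ℝ G] (T : (V →L[ℝ] F) →L[ℝ] G)
    {c : V → V →L[ℝ] ℝ} {f : V → F} {c' : V →L[ℝ] V →L[ℝ] ℝ} {f' : V →L[ℝ] F} {y : V}
    (hc : HasFDerivAt c c' y) (hf : HasFDerivAt f f' y) :
    HasFDerivAt (fun y => T ((c y).smulRight (f y)))
      (T ∘L ((ContinuousLinearMap.smulRightL ℝ V F).precompR V (c y) f' +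
        (ContinuousLinearMap.smulRightL ℝ V F).precompL V c' (f y))) y :=
  T.hasFDerivAt.comp y ((ContinuousLinearMap.smulRightL ℝ V F).hasFDerivAt_of_bilinear hc hf)

/-- The Leibniz rule `d(η ∧ a) = dη ∧ a - η ∧ da`. -/
theorem extDeriv_wedgeLeft {η : V → V [⋀^Fin 1]→L[ℝ] ℝ} {a : V → V [⋀^Fin k]→L[ℝ] ℝ} {y : V}
    (hη : DifferentiableAt ℝ η y) (ha : DifferentiableAt ℝ a y) :
    extDeriv (fun y => wedgeLeft (η y) (a y)) y + wedgeLeft (η y) (extDeriv a y) =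
      (1 / 2 : ℝ) • bilinWedge (twoFlat (extDeriv η y)) (a y) := by
  have hc : HasFDerivAt (fun y => covec (η y)) (covecL V ∘L fderiv ℝ η y) y :=
    (covecL V).hasFDerivAt.comp y hη.hasFDerivAt
  let S := ContinuousLinearMap.smulRightL ℝ V (V [⋀^Fin k]→L[ℝ] ℝ)
  have hW := (hasFDerivAt_clm_smulRight (alternatizeUncurryFinCLM ℝ V ℝ) hc ha.hasFDerivAt).fderiv
  -- The product rule separates the term differentiating a from the term differentiating η.
  have hd : extDeriv (fun y => wedgeLeft (η y) (a y)) y =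
      alternatizeUncurryFin (alternatizeUncurryFinCLM ℝ V ℝ ∘L
        S.precompR V (covec (η y)) (fderiv ℝ a y)) +
      bilinWedge (covecL V ∘L fderiv ℝ η y) (a y) := by
    rw [bilinWedge, ← alternatizeUncurryFin_add, ← ContinuousLinearMap.comp_add]
    exact congrArg alternatizeUncurryFin hW
  let T : V →L[ℝ] V →L[ℝ] V [⋀^Fin k]→L[ℝ] ℝ := (covec (η y)).smulRight (fderiv ℝ a y)
  have hT : wedgeLeft (η y) (extDeriv a y) =
      alternatizeUncurryFin (alternatizeUncurryFinCLM ℝ V ℝ ∘L T) := by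
    refine congrArg alternatizeUncurryFin (ContinuousLinearMap.ext fun v => ?_)
    exact (map_smul (alternatizeUncurryFinCLM ℝ V ℝ) (covec (η y) v) (fderiv ℝ a y)).symm
  -- The contributions containing the derivative of a combine to η(u) ∂ᵥa + η(v) ∂ᵤa, symmetric in u
  -- and v.
  have hsymm : alternatizeUncurryFin (alternatizeUncurryFinCLM ℝ V ℝ ∘L
      (S.precompR V (covec (η y)) (fderiv ℝ a y) + T)) = 0 :=
    alternatizeUncurryFin_alternatizeUncurryFinCLM_comp_of_symmetric fun u v => add_comm _ _
  rw [ContinuousLinearMap.comp_add, alternatizeUncurryFin_add] at hsymm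
  rw [hd, hT, extDeriv, ← bilinWedge_covecL_comp]
  refine (add_right_comm _ _ _).trans ?_
  exact (congrArg (· + _) hsymm).trans (zero_add _)

end Chart

/-! ### Operators on forms of all degrees -/

section Forms

variable {V : Type*} [NormedAddCommGroup V] [NormedSpace ℝ V]
  {M : Type*} [TopologicalSpace M] [ChartedSpace V M] {k : ℕ}

/-- The value of a form at a point. -/
def Form.eval (x : M) (k : ℕ) : Form V M k →ₗ[ℝ] V [⋀^Fin k]→L[ℝ] ℝ where
  toFun a := a.1 x
  map_add' _ _ := rfl
  map_smul' _ _ := rfl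

theorem Form.ext_eval {a b : Form V M k} (h : ∀ x, Form.eval x k a = Form.eval x k b) : a = b :=
  Subtype.ext (funext h)

/-- The values at a point of forms of all degrees. -/
def evalAll (x : M) : (∀ k, Form V M k) →ₗ[ℝ] ExtForms V :=
  LinearMap.pi fun k => Form.eval x k ∘ₗ LinearMap.proj k

theorem evalAll_raise_extMul (η : Form V M 1) (x : M) (α : ∀ k, Form V M k) :
    evalAll x (raise (extMul η) α) = covecMulTot (covec (Form.eval x 1 η)) (evalAll x α) := by
  funext k
  cases k <;> rfl

theorem subsingleton_form [FiniteDimensional ℝ V] (hk : Module.finrank ℝ V < k) :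
    Subsingleton (Form V M k) :=
  ⟨fun _ _ => Form.ext_eval fun _ => (subsingleton_of_finrank_lt hk).elim _ _⟩

theorem Form.differentiableAt (a : Form V M k) (x : M) :
    DifferentiableAt ℝ (formInChart a.1 x) (chartAt V x x) :=
  ((a.2 x).contDiffAt ((chartAt V x).open_target.mem_nhds
    ((chartAt V x).map_source (mem_chart_source V x)))).differentiableAt (by simp)

variable [IsManifold 𝓘(ℝ, V) ∞ M]

theorem extD_extD (a : Form V M k) : extD V M (k + 1) (extD V M k a) = 0 := by
  refine Form.ext_eval fun x => ?_
  have hx := (chartAt V x).open_target.mem_nhds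
    ((chartAt V x).map_source (mem_chart_source V x))
  have h1 : formInChart (extD V M k a).1 x =ᶠ[nhds (chartAt V x x)]
      extDeriv (formInChart a.1 x) := by
    filter_upwards [hx] with y hy using formInChart_extDerivFun a x hy
  have h2 : extDeriv (formInChart (extD V M k a).1 x) (chartAt V x x) = 0 := by
    rw [h1.extDeriv_eq]
    exact extDeriv_extDeriv_apply ((a.2 x).contDiffAt hx)
      (by simpa using WithTop.coe_le_coe.2 (le_top : (2 : ℕ∞) ≤ ⊤))
  exact congrArg (fun f : V [⋀^Fin (k + 2)]→L[ℝ] ℝ =>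
      f.compContinuousLinearMap (chartPush x x : V →L[ℝ] V)) h2

/-- The vector space Leibniz rule in the chart at x, pulled back to the tangent space at x. All the
operations involved are natural under pullback. -/
theorem eval_extD_extMul (η : Form V M 1) (a : Form V M k) (x : M) :
    Form.eval x (k + 2) (extD V M (k + 1) (extMul η k a) + extMul η (k + 1) (extD V M k a)) =
      (1 / 2 : ℝ) • bilinWedge (twoFlat (Form.eval x 2 (extD V M 1 η))) (Form.eval x k a) := by
  have h1 := extDeriv_wedgeLeft (η.differentiableAt x) (a.differentiableAt x)
  have h2 : formInChart (extMul η k a).1 x =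
      fun y => wedgeLeft (formInChart η.1 x y) (formInChart a.1 x y) :=
    funext fun y => formInChart_wedgeLeft η.1 a.1 x y
  rw [← h2] at h1
  have hη : (formInChart η.1 x (chartAt V x x)).compContinuousLinearMap
      (chartPush x x : V →L[ℝ] V) = Form.eval x 1 η :=
    formInChart_comp_chartPush η.1 x (mem_chart_source V x)
  have ha : (formInChart a.1 x (chartAt V x x)).compContinuousLinearMap
      (chartPush x x : V →L[ℝ] V) = Form.eval x k a :=
    formInChart_comp_chartPush a.1 x (mem_chart_source V x)
  have key : ∀ (A : V →L[ℝ] V) (p p' : V [⋀^Fin 1]→L[ℝ] ℝ) (w : V [⋀^Fin 2]→L[ℝ] ℝ)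
      (b b' : V [⋀^Fin k]→L[ℝ] ℝ) (c : V [⋀^Fin (k + 1)]→L[ℝ] ℝ) (f : V [⋀^Fin (k + 2)]→L[ℝ] ℝ),
      p.compContinuousLinearMap A = p' → b.compContinuousLinearMap A = b' →
      f + wedgeLeft p c = (1 / 2 : ℝ) • bilinWedge (twoFlat w) b →
      f.compContinuousLinearMap A + wedgeLeft p' (c.compContinuousLinearMap A) =
        (1 / 2 : ℝ) • bilinWedge (twoFlat (w.compContinuousLinearMap A)) b' := by
    rintro A p _ w b _ c f rfl rfl h
    rw [wedgeLeft_comp, twoFlat_comp, ← bilinWedge_comp]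
    exact congrArg (·.compContinuousLinearMap A) h
  exact key _ _ _ _ _ _ _ _ hη ha h1

theorem evalAll_extD_extMul [FiniteDimensional ℝ V] (η : Form V M 1) (x : M)
    (α : ∀ k, Form V M k) :
    evalAll x ((raise (extD V M) * raise (extMul η) + raise (extMul η) * raise (extD V M)) α) =
      twoMul (A := Module.End ℝ (ExtForms V)) covecMulTot
        (twoFlat (Form.eval x 2 (extD V M 1 η)) : V →ₗ[ℝ] (V →L[ℝ] ℝ)) (evalAll x α) := by
  funext k
  match k with
  | 0 =>
    rw [twoMul, LinearMap.smul_apply, Pi.smul_apply, LinearMap.sum_apply, Finset.sum_apply]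
    refine Eq.trans ?_ (smul_eq_zero_of_right _ (Finset.sum_eq_zero fun i _ => rfl)).symm
    exact (congrArg (Form.eval x 0) (add_zero 0)).trans (map_zero _)
  | 1 =>
    rw [twoMul, LinearMap.smul_apply, Pi.smul_apply, LinearMap.sum_apply, Finset.sum_apply]
    refine Eq.trans ?_ (smul_eq_zero_of_right _
      (Finset.sum_eq_zero fun i _ => map_zero (covecMul (dualVec i) 0))).symm
    change Form.eval x 1 (extD V M 0 0 + extMul η 0 0) = 0
    rw [map_zero, map_zero, add_zero, map_zero]
  | k + 2 =>
    rw [twoMul_covecMulTot_apply]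
    exact eval_extD_extMul η (α k) x

variable [FiniteDimensional ℝ V] {m : ℕ} {η : Form V M 1}

/-- The contact condition enters through the invertibility of ♭ and through dim M = 2m + 1, which
makes (dim M − 1)/2 equal to m. Nilpotency of i(Λ) holds because forms vanish above the dimension.
-/
theorem IsContact.contactRelations (h : IsContact m η) :
    ContactRelations (m : ℝ) (raise (extD V M)) (raise (extMul η)) (lower (interior h.reeb))
      (lowerTwo (contraction h.bivector)) (degree (Form V M)) := by
  have hodd : Odd (Module.finrank ℝ V) := ⟨m, h.1⟩
  have hm : (m : ℝ) = ((Module.finrank ℝ V : ℝ) - 1) / 2 := by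
    rw [h.1]; push_cast; ring
  rw [hm]
  refine ContactRelations.of_eval (ev := evalAll)
    (fun α β H => funext fun k => Form.ext_eval fun x => congrFun (H x) k)
    (fun x => (horizontalInverse hodd (h.isInvertible x)).pointRelations antiCommRelations)
    (evalAll_raise_extMul η) (fun x α => rfl) (fun x α => ?_) (fun x α => ?_)
    (evalAll_extD_extMul η) ?_ (degree_mul_raise _) (degree_mul_lowerTwo _) (degree_mul_raise _)
    (degree_mul_lower _)
    (isNilpotent_lowerTwo _ (Module.finrank ℝ V + 1) fun k hk => subsingleton_form hk)
  · exact DFunLike.congr_fun (lowerTwo_contractL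
      (compContinuousLinearMap_inverse_apply hodd (h.isInvertible x))) (evalAll x α)
  · rw [numberOp_eq]
    rfl
  · refine LinearMap.ext fun α => funext fun k => ?_
    match k with
    | 0 => rfl
    | 1 => exact map_zero (extD V M 0)
    | k + 2 => exact extD_extD (α k)

end Forms

/-! ### The identities in each degree -/

section Degreewise

variable {V : Type*} [NormedAddCommGroup V] [NormedSpace ℝ V]
  {M : Type*} [TopologicalSpace M] [ChartedSpace V M]

/-- The form of degree `k` as a family of forms of all degrees. -/
def Form.single {k : ℕ} (a : Form V M k) : ∀ k, Form V M k := Pi.single k a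

@[simp] theorem Form.single_same {k : ℕ} (a : Form V M k) : a.single k = a := Pi.single_eq_same k a

variable [IsManifold 𝓘(ℝ, V) ∞ M]

/-- The zero that `raise` puts in degree 0 reproduces the convention i_X = 0 on functions;
`koszul_apply` uses it likewise for i(P) on 1-forms. -/
theorem lieDeriv_apply (X : VectorField V M) (α : ∀ k, Form V M k) (k : ℕ) :
    lieDeriv X k (α k) = (raise (extD V M) * lower (interior X) +
      lower (interior X) * raise (extD V M)) α k := by
  cases k with
  | zero => exact (zero_add _).symm
  | succ k => exact add_comm _ _

variable [FiniteDimensional ℝ V]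

theorem koszul_apply (P : BivectorField V M) (α : ∀ k, Form V M k) (k : ℕ) :
    koszul P k (α (k + 1)) = (lowerTwo (contraction P) * raise (extD V M) -
      raise (extD V M) * lowerTwo (contraction P)) α k := by
  cases k with
  | zero => exact (sub_zero _).symm
  | succ k => rfl

/-! ### Operator identities on forms of one fixed degree -/

namespace IsContact

variable {m : ℕ} {η : Form V M 1} (h : IsContact m η)

/-- The method for all the identities in this group: apply the ring identity to the family supported
in the degree of a and read off one component. -/
theorem koszul_koszul (k : ℕ) (a : Form V M (k + 2)) :
    koszul h.bivector k (koszul h.bivector (k + 1) a) =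
      interior h.reeb k (koszul h.bivector (k + 1) a) +
        lieDeriv h.reeb k (contraction h.bivector k a) := by
  have H := congrFun (DFunLike.congr_fun h.contactRelations.koszul_sq a.single) k
  rw [Module.End.mul_apply, ← koszul_apply, ← koszul_apply, LinearMap.add_apply, Pi.add_apply,
    Module.End.mul_apply, lower_apply, ← koszul_apply, Module.End.mul_apply, ← lieDeriv_apply,
    lowerTwo_apply] at H
  simpa using H

theorem koszul_interior (k : ℕ) (a : Form V M (k + 2)) :
    koszul h.bivector k (interior h.reeb (k + 1) a) =
      -interior h.reeb k (koszul h.bivector (k + 1) a) := by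
  have H := congrFun (DFunLike.congr_fun h.contactRelations.koszul_i a.single) k
  rw [Module.End.mul_apply, ← koszul_apply, LinearMap.neg_apply, Pi.neg_apply,
    Module.End.mul_apply, lower_apply, lower_apply, ← koszul_apply] at H
  simpa using H

theorem koszul_lieDeriv (k : ℕ) (a : Form V M (k + 1)) :
    koszul h.bivector k (lieDeriv h.reeb (k + 1) a) =
      lieDeriv h.reeb k (koszul h.bivector k a) := by
  have H := congrFun (DFunLike.congr_fun h.contactRelations.koszul_lie a.single) k
  rw [Module.End.mul_apply, ← koszul_apply, ← lieDeriv_apply, Module.End.mul_apply,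
    ← lieDeriv_apply, ← koszul_apply] at H
  simpa using H

theorem interior_lieDeriv (k : ℕ) (a : Form V M (k + 1)) :
    interior h.reeb k (lieDeriv h.reeb (k + 1) a) =
      lieDeriv h.reeb k (interior h.reeb k a) := by
  have H := congrFun (DFunLike.congr_fun h.contactRelations.lie_i a.single) k
  rw [Module.End.mul_apply, ← lieDeriv_apply, lower_apply, Module.End.mul_apply,
    lower_apply, ← lieDeriv_apply] at H
  simpa using H.symm

theorem koszul_contraction (k : ℕ) (a : Form V M (k + 3)) :
    koszul h.bivector k (contraction h.bivector (k + 1) a) =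
      contraction h.bivector k (koszul h.bivector (k + 2) a) +
        (2 : ℝ) • interior h.reeb k (contraction h.bivector (k + 1) a) := by
  have H := congrFun (DFunLike.congr_fun h.contactRelations.koszul_L a.single) k
  rw [LinearMap.sub_apply, Pi.sub_apply, Module.End.mul_apply, ← koszul_apply, lowerTwo_apply,
    Module.End.mul_apply, lowerTwo_apply, ← koszul_apply, two_mul, LinearMap.add_apply,
    Pi.add_apply, Module.End.mul_apply, lower_apply, lowerTwo_apply, sub_eq_iff_eq_add,
    ← two_smul ℝ] at H
  simpa [add_comm] using H

theorem contraction_lieDeriv (k : ℕ) (a : Form V M (k + 2)) :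
    contraction h.bivector k (lieDeriv h.reeb (k + 2) a) =
      lieDeriv h.reeb k (contraction h.bivector k a) := by
  have H := congrFun (DFunLike.congr_fun h.contactRelations.L_lie a.single) k
  rw [Module.End.mul_apply, lowerTwo_apply, ← lieDeriv_apply, Module.End.mul_apply,
    ← lieDeriv_apply, lowerTwo_apply] at H
  simpa using H

theorem contraction_interior (k : ℕ) (a : Form V M (k + 3)) :
    contraction h.bivector k (interior h.reeb (k + 2) a) =
      interior h.reeb k (contraction h.bivector (k + 1) a) := by
  have H := congrFun (DFunLike.congr_fun h.contactRelations.L_i a.single) k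
  rw [Module.End.mul_apply, lowerTwo_apply, lower_apply, Module.End.mul_apply, lower_apply,
    lowerTwo_apply] at H
  simpa using H

theorem interior_interior (k : ℕ) (a : Form V M (k + 2)) :
    interior h.reeb k (interior h.reeb (k + 1) a) = 0 := by
  have H := congrFun (DFunLike.congr_fun h.contactRelations.i_i a.single) k
  rw [Module.End.mul_apply, lower_apply, lower_apply] at H
  simpa using H

theorem koszul_extMul_zero (a : Form V M 0) :
    koszul h.bivector 0 (extMul η 0 a) = (m : ℝ) • a := by
  have H := congrFun (DFunLike.congr_fun h.contactRelations.koszul_e a.single) 0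
  rw [Module.End.mul_apply, ← koszul_apply, raise_apply_succ, LinearMap.sub_apply,
    LinearMap.add_apply, LinearMap.sub_apply, Module.algebraMap_end_apply, Pi.sub_apply,
    Pi.add_apply, Pi.sub_apply, Module.End.mul_apply, Module.End.mul_apply, raise_apply_zero,
    raise_apply_zero, degree_apply] at H
  simpa using H

theorem koszul_extMul (k : ℕ) (a : Form V M (k + 1)) :
    koszul h.bivector (k + 1) (extMul η (k + 1) a) =
      (m - (k + 1) : ℝ) • a + extMul η k (interior h.reeb k a) -
        extMul η k (koszul h.bivector k a) := by
  have H := congrFun (DFunLike.congr_fun h.contactRelations.koszul_e a.single) (k + 1)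
  rw [Module.End.mul_apply, ← koszul_apply, raise_apply_succ, LinearMap.sub_apply,
    LinearMap.add_apply, LinearMap.sub_apply, Module.algebraMap_end_apply, Pi.sub_apply,
    Pi.add_apply, Pi.sub_apply, Module.End.mul_apply, Module.End.mul_apply, raise_apply_succ,
    raise_apply_succ, degree_apply, lower_apply, ← koszul_apply] at H
  simpa [sub_smul] using H

theorem interior_extMul_zero (a : Form V M 0) : interior h.reeb 0 (extMul η 0 a) = a := by
  have H := congrFun (DFunLike.congr_fun h.contactRelations.i_e a.single) 0
  rw [Module.End.mul_apply, lower_apply, raise_apply_succ, LinearMap.sub_apply, Pi.sub_apply,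
    Module.End.mul_apply, raise_apply_zero] at H
  simpa using H

theorem interior_extMul (k : ℕ) (a : Form V M (k + 1)) :
    interior h.reeb (k + 1) (extMul η (k + 1) a) = a - extMul η k (interior h.reeb k a) := by
  have H := congrFun (DFunLike.congr_fun h.contactRelations.i_e a.single) (k + 1)
  rw [Module.End.mul_apply, lower_apply, raise_apply_succ, LinearMap.sub_apply, Pi.sub_apply,
    Module.End.mul_apply, raise_apply_succ, lower_apply] at H
  simpa using H

theorem lieDeriv_extMul (k : ℕ) (a : Form V M k) :
    lieDeriv h.reeb (k + 1) (extMul η k a) = extMul η k (lieDeriv h.reeb k a) := by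
  have H := congrFun (DFunLike.congr_fun h.contactRelations.lie_e a.single) (k + 1)
  rw [Module.End.mul_apply, ← lieDeriv_apply, raise_apply_succ, Module.End.mul_apply,
    raise_apply_succ, ← lieDeriv_apply] at H
  simpa using H

theorem contraction_extMul_zero (a : Form V M 1) :
    contraction h.bivector 0 (extMul η 1 a) = 0 := by
  have H := congrFun (DFunLike.congr_fun h.contactRelations.L_e a.single) 0
  rw [Module.End.mul_apply, lowerTwo_apply, raise_apply_succ, Module.End.mul_apply,
    raise_apply_zero] at H
  simpa using H

theorem contraction_extMul (k : ℕ) (a : Form V M (k + 2)) :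
    contraction h.bivector (k + 1) (extMul η (k + 2) a) =
      extMul η k (contraction h.bivector k a) := by
  have H := congrFun (DFunLike.congr_fun h.contactRelations.L_e a.single) (k + 1)
  rw [Module.End.mul_apply, lowerTwo_apply, raise_apply_succ, Module.End.mul_apply,
    raise_apply_succ, lowerTwo_apply] at H
  simpa using H

/-! ### The Lichnerowicz-Jacobi complex of a contact manifold -/

theorem boundaryFst_apply (L : BivectorField V M) (E : VectorField V M) (k : ℕ)
    (a : Form V M (k + 1)) (b : Form V M k) :
    boundaryFst L E k (a, b) = koszul L k a + (k + 1 : ℝ) • interior E k a +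
      (-1 : ℝ) ^ (k + 1) • lieDeriv E k b := by
  rw [← Nat.cast_add_one]; rfl

theorem boundarySnd_apply (L : BivectorField V M) (E : VectorField V M) (k : ℕ)
    (a : Form V M (k + 2)) (b : Form V M (k + 1)) :
    boundarySnd L E k (a, b) = koszul L k b + (k + 1 : ℝ) • interior E k b +
      (-1 : ℝ) ^ (k + 2) • contraction L k a := by
  rw [← Nat.cast_add_one]; rfl

/-- On a, the anticommutation Ki = −iK reduces the mixed terms to −iK. By `koszul_koszul` what is
left of K² − iK is ℓL, cancelled by the sign product −1 of the two components. On b, ℓ commutes with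
K and i. -/
theorem boundaryFst_boundary (k : ℕ) (a : Form V M (k + 2)) (b : Form V M (k + 1)) :
    boundaryFst h.bivector h.reeb k (boundaryFst h.bivector h.reeb (k + 1) (a, b),
      boundarySnd h.bivector h.reeb k (a, b)) = 0 := by
  simp only [boundaryFst_apply, boundarySnd_apply, map_add, map_smul, h.koszul_koszul,
    h.koszul_interior, h.koszul_lieDeriv, h.interior_lieDeriv, h.interior_interior]
  -- Fixing the parity of k turns the signs into numerals, and the identity becomes linear.
  rcases neg_one_pow_eq_or ℝ k with hk | hk <;> simp only [pow_succ, hk] <;> push_cast <;> module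

/-- The new point is the part in a: the coefficients of iL differ by (k + 3) − (k + 1) = 2, exactly
the term 2iL in `koszul_contraction`. -/
theorem boundarySnd_boundary (k : ℕ) (a : Form V M (k + 3)) (b : Form V M (k + 2)) :
    boundarySnd h.bivector h.reeb k (boundaryFst h.bivector h.reeb (k + 2) (a, b),
      boundarySnd h.bivector h.reeb (k + 1) (a, b)) = 0 := by
  simp only [boundaryFst_apply, boundarySnd_apply, map_add, map_smul, h.koszul_koszul,
    h.koszul_interior, h.koszul_contraction, h.contraction_lieDeriv, h.contraction_interior,
    h.interior_interior]
  rcases neg_one_pow_eq_or ℝ k with hk | hk <;> simp only [pow_succ, hk] <;> push_cast <;> module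

theorem boundary_comp_boundary (k : ℕ) :
    boundary h.bivector h.reeb k ∘ₗ boundary h.bivector h.reeb (k + 1) = 0 := by
  refine LinearMap.ext ?_
  rintro ⟨a, b⟩
  cases k with
  | zero => exact h.boundaryFst_boundary 0 a b
  | succ k => exact Prod.ext (h.boundaryFst_boundary (k + 1) a b) (h.boundarySnd_boundary k a b)

theorem boundaryFst_extMul_zero (a b : Form V M 0) (hb : b = 0) :
    boundaryFst h.bivector h.reeb 0 (extMul η 0 a, b) = (m + 1 : ℝ) • a := by
  rw [boundaryFst_apply, h.koszul_extMul_zero, h.interior_extMul_zero, hb, map_zero]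
  push_cast
  module

/-- The constant is (m − (k + 1)) + (k + 2): the first from Ke + eK in degree k + 1, the second from
the coefficient of i_E in degree k + 2. The ℓ-terms cancel because the sign alternates with the
degree. -/
theorem boundaryFst_extMul (k : ℕ) (a : Form V M (k + 1)) (b : Form V M k) :
    boundaryFst h.bivector h.reeb (k + 1) (extMul η (k + 1) a, extMul η k b) =
      (m + 1 : ℝ) • a - extMul η k (boundaryFst h.bivector h.reeb k (a, b)) := by
  simp only [boundaryFst_apply, h.koszul_extMul, h.interior_extMul, h.lieDeriv_extMul, map_add,
    map_smul, pow_succ]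
  push_cast
  module

theorem boundarySnd_extMul_zero (a : Form V M 1) (b : Form V M 0) :
    boundarySnd h.bivector h.reeb 0 (extMul η 1 a, extMul η 0 b) = (m + 1 : ℝ) • b := by
  rw [boundarySnd_apply, h.koszul_extMul_zero, h.interior_extMul_zero, h.contraction_extMul_zero]
  push_cast
  module

theorem boundarySnd_extMul (k : ℕ) (a : Form V M (k + 2)) (b : Form V M (k + 1)) :
    boundarySnd h.bivector h.reeb (k + 1) (extMul η (k + 2) a, extMul η (k + 1) b) =
      (m + 1 : ℝ) • b - extMul η k (boundarySnd h.bivector h.reeb k (a, b)) := by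
  simp only [boundarySnd_apply, h.koszul_extMul, h.interior_extMul, h.contraction_extMul, map_add,
    map_smul, pow_succ]
  push_cast
  module

theorem boundary_extMulChain (k : ℕ) (c : Chain V M k) (hc : c ∈ cycles h.bivector h.reeb k) :
    boundary h.bivector h.reeb k (extMulChain η k c) = (m + 1 : ℝ) • c := by
  -- Degrees 0 and 1 stand apart because one or both components of the boundary of c are then
  -- absent; the corresponding formulas have no correction term eδ.
  match k with
  | 0 => exact h.boundaryFst_extMul_zero c _ rfl
  | 1 =>
    obtain ⟨a, b⟩ := c
    have h1 : boundaryFst h.bivector h.reeb 0 (a, b) = 0 := hc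
    refine Prod.ext ((h.boundaryFst_extMul 0 a b).trans ?_) (h.boundarySnd_extMul_zero a b)
    rw [h1, map_zero, sub_zero]
    rfl
  | k + 2 =>
    obtain ⟨a, b⟩ := c
    have h1 : boundaryFst h.bivector h.reeb (k + 1) (a, b) = 0 := congrArg Prod.fst hc
    have h2 : boundarySnd h.bivector h.reeb k (a, b) = 0 := congrArg Prod.snd hc
    refine Prod.ext ((h.boundaryFst_extMul (k + 1) a b).trans ?_)
      ((h.boundarySnd_extMul k a b).trans ?_)
    · rw [h1, map_zero, sub_zero]
      rfl
    · rw [h2, map_zero, sub_zero]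
      rfl

theorem boundary_smul_extMulChain (k : ℕ) (c : Chain V M k)
    (hc : c ∈ cycles h.bivector h.reeb k) :
    boundary h.bivector h.reeb k ((1 / (m + 1) : ℝ) • extMulChain η k c) = c := by
  rw [map_smul, h.boundary_extMulChain k c hc, smul_smul,
    one_div_mul_cancel (by positivity), one_smul]

theorem subsingleton_homology (k : ℕ) : Subsingleton (Homology h.bivector h.reeb k) := by
  rw [Submodule.Quotient.subsingleton_iff, eq_top_iff]
  exact fun c _ => ⟨_, h.boundary_smul_extMulChain k c.1 c.2⟩

end IsContact

end Degreewise

end LJ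

end


theorem theorem4p10 {V : Type*} [NormedAddCommGroup V] [NormedSpace ℝ V] [FiniteDimensional ℝ V]
    {M : Type*} [TopologicalSpace M] [ChartedSpace V M] [IsManifold 𝓘(ℝ, V) ∞ M]
    (m : ℕ) (η : Form V M 1) (h : IsContact m η) :
    (∀ k, boundary h.bivector h.reeb k ∘ₗ boundary h.bivector h.reeb (k + 1) = 0) ∧
      (∀ k, Subsingleton (Homology h.bivector h.reeb k)) ∧
      ∀ k, ∀ c ∈ cycles h.bivector h.reeb k,
        boundary h.bivector h.reeb k ((1 / (m + 1) : ℝ) • extMulChain η k c) = c :=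
  ⟨h.boundary_comp_boundary, h.subsingleton_homology, h.boundary_smul_extMulChain⟩
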